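/- Let $\mathfrak g$ be a finite-dimensional simple complex Lie algebra of type $A_n$ ($n\ge 1$) or $D_n$ ($n\ge 4$), with Cartan subalgebra $\mathfrak h$, simple roots $\alpha_1,\dots,\alpha_n$ numbered as usual (in type $D_n$, nodes $n-1$ and $n$ are the spin nodes), positive roots $R^+$, coroots $h_\alpha$ (with $h_i=h_{\alpha_i}$), root vectors $x_\alpha^\pm$ (with $x_i^\pm=x_{\alpha_i}^\pm$), weight lattice $P$ and dominant integral weights $P^+$. Put $\mathfrak n^+=\bigoplus_{\alpha\in R^+}\mathbb C x_\alpha^+$ and $\mathfrak g[t]=\mathfrak g\otimes\mathbb C[t]$. For $\lambda,\mu\in P^+$ let $V(\lambda,\mu)$ be the $\mathfrak g[t]$-module generated by an element $w_{\lambda,\mu}$ with defining relations $$\mathfrak n^+[t]w_{\lambda,\mu}=0,\quad (h\otimes t^r)w_{\lambda,\mu}=\delta_{r,0}(\lambda+\mu)(h)w_{\lambda,\mu}\ (h\in\mathfrak h,\ r\ge 0),\quad (x_i^-\otimes 1)^{(\lambda+\mu)(h_i)+1}w_{\lambda,\mu}=0\ (1\le i\le n),$$ $$(x_\alpha^-\otimes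 t^{\max\{\lambda(h_\alpha),\mu(h_\alpha)\}})w_{\lambda,\mu}=0\ (\alpha\in R^+).$$ A pair $(\lambda_1,\lambda_2)$ in $P^+\times P^+$ is called interlacing if $(\lambda_1+\lambda_2)(h_i)\le 1$ for all $i$ and, for $\{r,p\}=\{1,2\}$: (a) if $n\ge2$ and $\lambda_r(h_{n-1}+h_n)>0$, then $\lambda_p(h_{n-1}+h_n)=0$; (b) for all $1\le i<j\le n$ with $(i,j)\ne(n-1,n)$, if $\lambda_r(h_i)=1=\lambda_r(h_j)$, then $\lambda_p(h_s)=1$ for some $i<s<j$. Let $(\lambda_1,\lambda_2)\in P^+\times P^+$ be interlacing, let $\nu\in P^+$ (for instance $\nu=0$), and put $\nu_1=\lambda_1+\nu$, $\nu_2=\lambda_2+\nu$. Suppose that $\beta\in R^+$ is of minimal height among the positive roots with $$u_\beta:=(x_\beta^-\otimes t^{\lceil(\nu_1+\nu_2)(h_\beta)/2\rceil})w_{\nu_1,\nu_2}\ne 0 .$$ If $\nu_1(h_\beta)>\nu_2(h_\beta)$, then $\nu_1-\beta\in P^+$ and there is a surjective map of $\mathfrak g[t]$-modules from $V(\nu_1-\beta,\nu_2)$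 onto the submodule $\langle u_\beta\rangle=\mathbf U(\mathfrak g[t])u_\beta$ of $V(\nu_1,\nu_2)$, with $w_{\nu_1-\beta,\nu_2}\mapsto u_\beta$. Symmetrically, if $\nu_2(h_\beta)>\nu_1(h_\beta)$, then $\nu_2-\beta\in P^+$ and there is a surjective map of $\mathfrak g[t]$-modules from $V(\nu_1,\nu_2-\beta)$ onto $\langle u_\beta\rangle$, with $w_{\nu_1,\nu_2-\beta}\mapsto u_\beta$. -/

import Mathlib

open scoped TensorProduct Polynomial

noncomputable section

namespace CurrentAlg

open LieAlgebra LieAlgebra.IsKilling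

/-- The current algebra `𝔤[t] = ℂ[t] ⊗ 𝔤`, with bracket `[f ⊗ x, g ⊗ y] = fg ⊗ [x, y]`. -/
abbrev Current (𝔤 : Type*) [LieRing 𝔤] [LieAlgebra ℂ 𝔤] : Type _ := ℂ[X] ⊗[ℂ] 𝔤

/-- The universal enveloping algebra `U(𝔤[t])`. A `𝔤[t]`-module is a left `U(𝔤[t])`-module. -/
abbrev UCurrent (𝔤 : Type*) [LieRing 𝔤] [LieAlgebra ℂ 𝔤] : Type _ :=
  UniversalEnvelopingAlgebra ℂ (Current 𝔤)

/-- The element `x ⊗ t ^ r`, regarded in `U(𝔤[t])`. -/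
def cur {𝔤 : Type*} [LieRing 𝔤] [LieAlgebra ℂ 𝔤] (x : 𝔤) (r : ℕ) : UCurrent 𝔤 :=
  UniversalEnvelopingAlgebra.ι ℂ (((Polynomial.X : ℂ[X]) ^ r) ⊗ₜ[ℂ] x)

section Weights

variable {𝔤 : Type*} [LieRing 𝔤] [LieAlgebra ℂ 𝔤] [FiniteDimensional ℂ 𝔤] [IsKilling ℂ 𝔤]
  (H : LieSubalgebra ℂ 𝔤) [H.IsCartanSubalgebra]

/-- The weight lattice `P`: linear forms on the Cartan subalgebra that take integral values on all
coroots `h_α` (equivalently on the simple ones, so this is the span of the fundamental weights). -/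
def weightLattice : AddSubgroup (Module.Dual ℂ H) where
  carrier := {lam | ∀ α : H.root, ∃ z : ℤ, lam (coroot α.1) = z}
  zero_mem' := fun _ => ⟨0, by simp⟩
  add_mem' := by
    intro a c ha hc α
    obtain ⟨z, hz⟩ := ha α
    obtain ⟨y, hy⟩ := hc α
    exact ⟨z + y, by simp [hz, hy]⟩
  neg_mem' := by
    intro a ha α
    obtain ⟨z, hz⟩ := ha α
    exact ⟨-z, by simp [hz]⟩

variable {H}

/-- The integer `λ(h_α)`, for an integral weight `λ` and a root `α`. -/
def value (lam : weightLattice H) (α : H.root) : ℤ := (lam.2 α).choose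

theorem value_spec (lam : weightLattice H) (α : H.root) :
    (lam : Module.Dual ℂ H) (coroot α.1) = value lam α :=
  (lam.2 α).choose_spec

/-- A root, regarded as an element of the weight lattice. -/
def rootWeight (β : H.root) : weightLattice H :=
  ⟨(rootSystem H).root β, fun α =>
    ⟨(rootSystem H).pairingIn ℤ β α, by
      have h := (rootSystem H).algebraMap_pairingIn ℤ β α
      rw [rootSystem_pairing_apply] at h
      rw [rootSystem_root_apply]
      simpa using h.symm⟩⟩

/-- Dominance: `λ ∈ P⁺` iff `λ(h_i) ≥ 0` for all simple roots. -/
def IsDominant (b : (rootSystem H).Base) (lam : weightLattice H) : Prop :=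
  ∀ i ∈ b.support, 0 ≤ value lam i

/-- The generators of the left ideal of `U(𝔤[t])` that defines `V(λ, μ)`. Root vectors are taken
to be arbitrary elements of the (one-dimensional) root spaces. -/
inductive IsRelator (b : (rootSystem H).Base) (lam mu : weightLattice H) : UCurrent 𝔤 → Prop
  /-- `𝔫⁺[t] w = 0`. -/
  | raising (α : H.root) (hα : b.IsPos α) (x : 𝔤) (hx : x ∈ rootSpace H (α.1 : H → ℂ)) (r : ℕ) :
      IsRelator b lam mu (cur x r)
  /-- `(h ⊗ t ^ r) w = δ_{r,0} (λ + μ)(h) w`. -/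
  | cartan (h : H) (r : ℕ) :
      IsRelator b lam mu (cur (h : 𝔤) r -
        algebraMap ℂ (UCurrent 𝔤) (if r = 0 then ((lam + mu : weightLattice H) : Module.Dual ℂ H) h
          else 0))
  /-- `(x_i⁻ ⊗ 1) ^ ((λ + μ)(h_i) + 1) w = 0`. -/
  | integrable (i : H.root) (hi : i ∈ b.support) (x : 𝔤)
      (hx : x ∈ rootSpace H (-(i.1 : H → ℂ))) :
      IsRelator b lam mu (cur x 0 ^ ((value (lam + mu) i).toNat + 1))
  /-- `(x_α⁻ ⊗ t ^ max {λ(h_α), μ(h_α)}) w = 0`. -/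
  | lowering (α : H.root) (hα : b.IsPos α) (x : 𝔤)
      (hx : x ∈ rootSpace H (-(α.1 : H → ℂ))) :
      IsRelator b lam mu (cur x (max (value lam α) (value mu α)).toNat)

/-- The left ideal of `U(𝔤[t])` generated by the defining relations of `V(λ, μ)`. -/
def relIdeal (b : (rootSystem H).Base) (lam mu : weightLattice H) :
    Submodule (UCurrent 𝔤) (UCurrent 𝔤) :=
  Submodule.span (UCurrent 𝔤) {u | IsRelator b lam mu u}

/-- The cyclic `𝔤[t]`-module `V(λ, μ)` (of interest for dominant `λ` and `μ`). -/
abbrev V (b : (rootSystem H).Base) (lam mu : weightLattice H) : Type _ :=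
  UCurrent 𝔤 ⧸ relIdeal b lam mu

/-- The generator `w_{λ, μ}` of `V(λ, μ)`. -/
def gen (b : (rootSystem H).Base) (lam mu : weightLattice H) : V b lam mu :=
  (relIdeal b lam mu).mkQ 1

/-- The vector `(x ⊗ t ^ ⌈(λ + μ)(h_β) / 2⌉) w_{λ, μ}` of `V(λ, μ)`. -/
def midVector (b : (rootSystem H).Base) (lam mu : weightLattice H) (β : H.root) (x : 𝔤) :
    V b lam mu :=
  cur x ⌈(value (lam + mu) β : ℚ) / 2⌉₊ • gen b lam mu

/-- The simple roots are numbered by `e` as in the standard Dynkin diagram of type `A_n` (`n ≥ 1`)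
or `D_n` (`n ≥ 4`); in type `D_n` the last two nodes are the spin nodes. -/
def IsTypeAD (b : (rootSystem H).Base) {n : ℕ} (e : Fin n ≃ b.support) : Prop :=
  (1 ≤ n ∧ ∀ i j, b.cartanMatrix (e i) (e j) = CartanMatrix.A n i j) ∨
    (4 ≤ n ∧ ∀ i j, b.cartanMatrix (e i) (e j) = CartanMatrix.D n i j)

end Weights

/-- One half of the interlacing condition, for the coordinates with respect to the fundamental
weights (numbered from `0`, so that the last two have numbers `n - 2` and `n - 1`). -/
structure HalfInterlacing {n : ℕ} (a c : Fin n → ℤ) : Prop where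
  last : ∀ i j : Fin n, i.val + 2 = n → j.val + 1 = n → 0 < a i + a j → c i + c j = 0
  between : ∀ i j : Fin n, i < j → ¬ (i.val + 2 = n ∧ j.val + 1 = n) → a i = 1 → a j = 1 →
    ∃ s, i < s ∧ s < j ∧ c s = 1

/-- The pair of integral weights `(λ₁, λ₂)` is interlacing. The requirement `λ₁ + λ₂ ∈ P⁺(1)` reads
`0 ≤ (λ₁ + λ₂)(h_i) ≤ d_i` and `d_i = 1` in the simply laced types. -/
structure IsInterlacing {𝔤 : Type*} [LieRing 𝔤] [LieAlgebra ℂ 𝔤] [FiniteDimensional ℂ 𝔤]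
    [IsKilling ℂ 𝔤] {H : LieSubalgebra ℂ 𝔤} [H.IsCartanSubalgebra] {b : (rootSystem H).Base}
    {n : ℕ} (e : Fin n ≃ b.support) (lam₁ lam₂ : weightLattice H) : Prop where
  sum_nonneg : ∀ i, 0 ≤ value (lam₁ + lam₂) (e i)
  sum_le_one : ∀ i, value (lam₁ + lam₂) (e i) ≤ 1
  left : HalfInterlacing (fun i => value lam₁ (e i)) (fun i => value lam₂ (e i))
  right : HalfInterlacing (fun i => value lam₂ (e i)) (fun i => value lam₁ (e i))

end CurrentAlg

end

/-!
The root system is simply laced, and its positive roots are `ε_i ± ε_j` in the standard lattice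
model. Interlacing says that the nonzero values of `λ₁ - λ₂` on the simple coroots alternate in
sign, so its coordinates in that model lie in `{-1, 0, 1}`, and `|(ν₁ - ν₂)(h_α)| ≤ 2` for every
positive root `α`.

Let `ν₁(h_β) > ν₂(h_β)`. As `x_β⁻ ⊗ t ^ ν₁(h_β)` kills the generator `w` and `u_β ≠ 0`, the
difference at `β` is exactly `2`. If `β = α + γ` with positive roots `α`, `γ`, then minimality of
the height of `β` forces the difference to be `1` at both `α` and `γ`, since otherwise `u_β` would
be a multiple of the action on `w` of the commutator of two elements killing `w`. This yields the
dominance of `ν₁ - β` and `𝔫⁺[t] u_β = 0`.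

The relations at the exponents `max ((ν₁ - β)(h_α)) (ν₂(h_α))` reduce, by commutators of root
vectors, to the identities `(x_α⁻ ⊗ t ^ s) (x_α⁻ ⊗ t ^ (s + 1)) w = 0` and
`(x_α⁻ ⊗ t ^ s) ^ 2 w = 0` in the current algebra of `𝔰𝔩₂`. They come from Garland's formula, which
writes `(x_α⁺ ⊗ t) ^ r (x_α⁻ ⊗ 1) ^ (r + 2) w` as a multiple of
`∑ (x_α⁻ ⊗ t ^ p) (x_α⁻ ⊗ t ^ q) w` over `p + q = r`.
-/

noncomputable section

namespace CurrentAlg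

section CommutatorIdentities

theorem two_mul_choose_two_succ (n : ℕ) : (2 * (n + 1).choose 2 : ℤ) = (n + 1) * n := by
  have h := Nat.add_one_mul_choose_eq n 1
  rw [Nat.choose_one_right] at h
  exact_mod_cast (h.trans (mul_comm _ _)).symm

variable {A : Type*} [Ring A]

theorem lie_pow_succ_of_commute {e f : A} (hf : Commute ⁅⁅e, f⁆, f⁆ f) (n : ℕ) :
    ⁅e, f ^ (n + 1)⁆ =
      (n + 1) • (f ^ n * ⁅e, f⁆) + (n + 1).choose 2 • (f ^ (n - 1) * ⁅⁅e, f⁆, f⁆) := by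
  induction n with
  | zero => simp
  | succ n ih =>
    have hswap : ⁅e, f⁆ * f = f * ⁅e, f⁆ + ⁅⁅e, f⁆, f⁆ := by rw [Ring.lie_def ⁅e, f⁆]; abel
    have hpow : (n + 1).choose 2 • (f ^ (n - 1) * ⁅⁅e, f⁆, f⁆ * f) =
        (n + 1).choose 2 • (f ^ n * ⁅⁅e, f⁆, f⁆) := by
      cases n with
      | zero => simp
      | succ n => rw [mul_assoc, hf.eq, ← mul_assoc, Nat.add_sub_cancel, ← pow_succ]
    calc ⁅e, f ^ (n + 2)⁆ = ⁅e, f ^ (n + 1)⁆ * f + f ^ (n + 1) * ⁅e, f⁆ := by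
          simp only [Ring.lie_def, pow_succ]; noncomm_ring
      _ = (n + 2) • (f ^ (n + 1) * ⁅e, f⁆) + (n + 2).choose 2 • (f ^ n * ⁅⁅e, f⁆, f⁆) := by
          rw [ih, add_mul, smul_mul_assoc, smul_mul_assoc, hpow, mul_assoc, hswap, mul_add,
            ← mul_assoc, ← pow_succ, Nat.choose_succ_succ (n + 1) 1, Nat.choose_one_right]
          module

variable {M : Type*} [AddCommGroup M] [Module A M]

theorem exists_pow_smul_smul_eq_zero {f u : A} {k : ℕ} (hu : (⁅f, ·⁆)^[k] u = 0) {n : ℕ} {v : M}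
    (hv : f ^ n • v = 0) : ∃ N : ℕ, f ^ N • u • v = 0 := by
  induction k generalizing u n v with
  | zero => exact ⟨0, by simp [show u = 0 from hu]⟩
  | succ k ih_bracket =>
    induction n generalizing v with
    | zero => exact ⟨0, by simp [show v = 0 by simpa using hv]⟩
    | succ n ih_vector =>
      obtain ⟨p, hp⟩ := ih_bracket (u := ⁅f, u⁆) hu hv
      obtain ⟨q, hq⟩ := ih_vector (v := f • v) (by rw [← mul_smul, ← pow_succ, hv])
      have leibniz : f • u • v = ⁅f, u⁆ • v + u • f • v := by
        rw [Ring.lie_def, sub_smul, mul_smul, mul_smul, sub_add_cancel]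
      refine ⟨p + q + 1, ?_⟩
      rw [pow_succ, mul_smul, leibniz, smul_add, pow_add, mul_smul _ _ (u • _), hq, smul_zero,
        add_zero, (Commute.pow_pow_self f p q).eq, mul_smul, hp, smul_zero]

theorem smul_pow_succ_smul {e f : A} {v : M} (hf : Commute ⁅⁅e, f⁆, f⁆ f) (hev : e • v = 0)
    (n : ℕ) : e • f ^ (n + 1) • v =
      (n + 1) • f ^ n • ⁅e, f⁆ • v + (n + 1).choose 2 • f ^ (n - 1) • ⁅⁅e, f⁆, f⁆ • v := by
  have h := congrArg (· • v) (lie_pow_succ_of_commute hf n)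
  simpa only [Ring.lie_def e (f ^ _), sub_smul, add_smul, smul_assoc, mul_smul, hev, smul_zero,
    sub_zero] using h

theorem smul_pow_succ_smul_of_sl2 {e f : A} {v : M} {m : ℤ} (hf : ⁅⁅e, f⁆, f⁆ = (-2 : ℤ) • f)
    (hev : e • v = 0) (hv : ⁅e, f⁆ • v = m • v) (n : ℕ) :
    e • f ^ (n + 1) • v = ((n + 1) * (m - n) : ℤ) • f ^ n • v := by
  rw [smul_pow_succ_smul (by rw [hf]; exact (Commute.refl f).smul_left _) hev, hv, hf]
  cases n with
  | zero => simp
  | succ n =>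
    rw [Nat.add_sub_cancel, smul_assoc, smul_comm _ (-2 : ℤ), smul_comm _ m, ← mul_smul (f ^ n),
      ← pow_succ, ← natCast_zsmul, ← natCast_zsmul, smul_smul, smul_smul, ← add_smul]
    congr 1
    have hchoose := two_mul_choose_two_succ (n + 1)
    push_cast at hchoose ⊢
    linear_combination -hchoose

variable [IsAddTorsionFree M]

theorem pow_smul_eq_zero_of_commutator {e x : A} {v : M} (he : Commute ⁅e, x⁆ e)
    (hx : Commute ⁅e, x⁆ x) (hev : e • v = 0) {n : ℕ} (hxv : x ^ n • v = 0) :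
    ⁅e, x⁆ ^ n • v = 0 := by
  induction n generalizing v with
  | zero => simpa using hxv
  | succ n ih =>
    have hlie : ⁅⁅e, x⁆, x⁆ = 0 := sub_eq_zero.mpr hx.eq
    have key : (n + 1) • x ^ n • ⁅e, x⁆ • v = 0 := by
      have h := smul_pow_succ_smul (f := x) (by rw [hlie]; exact .zero_left x) hev n
      simpa only [hlie, hxv, zero_smul, smul_zero, add_zero] using h.symm
    rw [pow_succ, mul_smul]
    refine ih ?_ ((smul_eq_zero_iff_right n.succ_ne_zero).mp key)
    rw [← mul_smul, ← he.eq, mul_smul, hev, smul_zero]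

theorem smul_lie_smul_eq_zero {a c : A} {v : M} (h : Commute a ⁅a, c⁆) (ha : a • a • v = 0)
    (hc : c • v = 0) : a • ⁅a, c⁆ • v = 0 := by
  have hv : ⁅a, c⁆ • v = -(c • a • v) := by
    rw [Ring.lie_def, sub_smul, mul_smul, mul_smul, hc, smul_zero, zero_sub]
  have hav : a • ⁅a, c⁆ • v = a • c • a • v := by
    rw [← mul_smul, h.eq, Ring.lie_def, sub_mul, sub_smul]
    simp only [mul_smul, ha, smul_zero, sub_zero]
  exact hav.trans (self_eq_neg.mp (hav.symm.trans (by rw [hv, smul_neg])))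

theorem exists_pow_smul_eq_zero_of_commutator {e x : A} (he : Commute ⁅e, x⁆ e)
    (hx : Commute ⁅e, x⁆ x) (he' : ∀ v : M, ∃ n : ℕ, e ^ n • v = 0)
    (hx' : ∀ v : M, ∃ n : ℕ, x ^ n • v = 0) (v : M) : ∃ n : ℕ, ⁅e, x⁆ ^ n • v = 0 := by
  obtain ⟨k, hk⟩ := he' v
  induction k generalizing v with
  | zero => exact ⟨0, by simpa using hk⟩
  | succ k ih =>
    obtain ⟨n, hn⟩ := ih (e • v) (by rw [← mul_smul, ← pow_succ, hk])
    have hev : e • ⁅e, x⁆ ^ n • v = 0 := by rw [← mul_smul, ← (he.pow_left n).eq, mul_smul, hn]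
    obtain ⟨m, hm⟩ := hx' (⁅e, x⁆ ^ n • v)
    exact ⟨m + n, by rw [pow_add, mul_smul, pow_smul_eq_zero_of_commutator he hx hev hm]⟩

theorem pow_succ_smul_eq_zero_of_sl2 {e f : A} {v : M} {N : ℕ} (hf : ⁅⁅e, f⁆, f⁆ = (-2 : ℤ) • f)
    (hev : e • v = 0) (hv : ⁅e, f⁆ • v = (N : ℤ) • v) {n : ℕ} (hn : f ^ n • v = 0) :
    f ^ (N + 1) • v = 0 := by
  rcases le_total n (N + 1) with hle | hle
  · rw [← Nat.sub_add_cancel hle, pow_add, mul_smul, hn, smul_zero]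
  induction n, hle using Nat.le_induction with
  | base => exact hn
  | succ n hle ih =>
    refine ih ?_
    have h := smul_pow_succ_smul_of_sl2 hf hev hv n
    rw [hn, smul_zero, eq_comm] at h
    refine (smul_eq_zero.mp h).resolve_left (mul_ne_zero ?_ ?_) <;> omega

end CommutatorIdentities

section EulerOperator

variable {A : Type*} [Ring A]

/-- The Euler operator `t d/dt` on power series over a ring that need not be commutative. -/
def eulerOp (F : PowerSeries A) : PowerSeries A :=
  PowerSeries.mk fun n => n • PowerSeries.coeff n F

@[simp]
theorem coeff_eulerOp (F : PowerSeries A) (n : ℕ) :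
    PowerSeries.coeff n (eulerOp F) = n • PowerSeries.coeff n F :=
  PowerSeries.coeff_mk _ _

theorem eulerOp_one : eulerOp (1 : PowerSeries A) = 0 := by
  ext n
  cases n <;> simp [PowerSeries.coeff_one]

theorem eulerOp_mul (F G : PowerSeries A) :
    eulerOp (F * G) = eulerOp F * G + F * eulerOp G := by
  ext n
  simp only [coeff_eulerOp, map_add, PowerSeries.coeff_mul, Finset.smul_sum,
    ← Finset.sum_add_distrib]
  refine Finset.sum_congr rfl fun p hp => ?_
  rw [smul_mul_assoc, mul_smul_comm, ← add_smul, Finset.HasAntidiagonal.mem_antidiagonal.mp hp]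

theorem eulerOp_pow {F : PowerSeries A} (hF : Commute F (eulerOp F)) (n : ℕ) :
    eulerOp (F ^ n) = n • (F ^ (n - 1) * eulerOp F) := by
  induction n with
  | zero => simp [eulerOp_one]
  | succ n ih =>
    have hpow : n • (F ^ (n - 1) * F) = n • F ^ n := by
      cases n with
      | zero => simp
      | succ n => rw [Nat.add_sub_cancel, ← pow_succ]
    rw [pow_succ, eulerOp_mul, ih, smul_mul_assoc, mul_assoc, ← hF.eq, ← mul_assoc,
      ← smul_mul_assoc, hpow, smul_mul_assoc, Nat.add_sub_cancel, succ_nsmul]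

theorem commute_eulerOp_mk {f : ℕ → A} (hf : ∀ p q, Commute (f p) (f q)) :
    Commute (PowerSeries.mk f) (eulerOp (PowerSeries.mk f)) := by
  ext n
  rw [PowerSeries.coeff_mul, PowerSeries.coeff_mul, ← Finset.Nat.sum_antidiagonal_swap]
  refine Finset.sum_congr rfl fun p _ => ?_
  simp only [coeff_eulerOp, PowerSeries.coeff_mk, Prod.fst_swap, Prod.snd_swap, mul_smul_comm,
    smul_mul_assoc, (hf p.1 p.2).eq]

end EulerOperator

section GarlandIdentity

open PowerSeries

variable {A : Type*} [Ring A] {e : A} {f h : ℕ → A}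

theorem coeff_succ_lie_X_mul_C (e : A) (F : PowerSeries A) (n : ℕ) :
    coeff (n + 1) ⁅X * C e, F⁆ = ⁅e, coeff n F⁆ := by
  rw [Ring.lie_def, Ring.lie_def, ← mul_assoc F, (commute_X F).eq, mul_assoc, mul_assoc,
    map_sub, coeff_succ_X_mul, coeff_succ_X_mul, coeff_C_mul, coeff_mul_C]

theorem lie_X_mul_C_mk (hef : ∀ p, ⁅e, f p⁆ = h (p + 1)) :
    ⁅X * C e, mk f⁆ = X * mk fun n => h (n + 1) := by
  ext (_ | n)
  · simp [Ring.lie_def, mul_assoc]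
  · rw [coeff_succ_lie_X_mul_C, coeff_succ_X_mul, coeff_mk, coeff_mk, hef]

theorem lie_X_mul_mk_mk (hhf : ∀ q p, ⁅h q, f p⁆ = (-2 : ℤ) • f (q + p)) :
    ⁅X * mk fun n => h (n + 1), mk f⁆ = (-2 : ℤ) • eulerOp (mk f) := by
  ext (_ | n)
  · rw [map_zsmul, coeff_eulerOp, zero_smul, smul_zero]
    simp [Ring.lie_def, mul_assoc]
  · have hterm : ∀ p ∈ Finset.HasAntidiagonal.antidiagonal n,
        h (p.1 + 1) * f p.2 - f p.2 * h (p.1 + 1) = (-2 : ℤ) • f (n + 1) := fun p hp => by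
      rw [← Ring.lie_def, hhf, add_right_comm, Finset.HasAntidiagonal.mem_antidiagonal.mp hp]
    rw [Ring.lie_def, map_sub, ← mul_assoc (mk f), (commute_X (mk f)).eq, mul_assoc, mul_assoc,
      coeff_succ_X_mul, coeff_succ_X_mul, coeff_mul, coeff_mul,
      ← Finset.Nat.sum_antidiagonal_swap (n := n) (f := fun p => coeff p.1 (mk f) * _)]
    simp only [coeff_mk, Prod.fst_swap, Prod.snd_swap]
    rw [← Finset.sum_sub_distrib, Finset.sum_congr rfl hterm, Finset.sum_const,
      Finset.Nat.card_antidiagonal, map_zsmul, coeff_eulerOp, coeff_mk, smul_comm]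

theorem lie_X_mul_C_pow_succ (hef : ∀ p, ⁅e, f p⁆ = h (p + 1))
    (hhf : ∀ q p, ⁅h q, f p⁆ = (-2 : ℤ) • f (q + p)) (hff : ∀ p q, Commute (f p) (f q)) (r : ℕ) :
    ⁅X * C e, mk f ^ (r + 1)⁆ = X * ((r + 1) • (mk f ^ r * mk fun n => h (n + 1))) -
      (r + 1) • eulerOp (mk f ^ r) := by
  have hF := commute_eulerOp_mk hff
  have hc : ⁅⁅X * C e, mk f⁆, mk f⁆ = (-2 : ℤ) • eulerOp (mk f) := by
    rw [lie_X_mul_C_mk hef, lie_X_mul_mk_mk hhf]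
  have hchoose : ((r + 1).choose 2 : ℤ) * -2 = -((r + 1) * r) := by
    linear_combination -two_mul_choose_two_succ r
  rw [lie_pow_succ_of_commute (by rw [hc]; exact hF.symm.smul_left _), hc, lie_X_mul_C_mk hef,
    eulerOp_pow hF, ← mul_assoc, (commute_X (mk f ^ r)).eq, mul_assoc, mul_smul_comm,
    sub_eq_add_neg, mul_smul_comm, ← natCast_zsmul _ ((r + 1).choose 2), smul_smul, hchoose]
  simp only [neg_smul, mul_smul, ← Nat.cast_succ, natCast_zsmul]

variable {M : Type*} [AddCommGroup M] [Module A M] {w : M}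

theorem lie_coeff_pow_succ_smul (hef : ∀ p, ⁅e, f p⁆ = h (p + 1))
    (hhf : ∀ q p, ⁅h q, f p⁆ = (-2 : ℤ) • f (q + p)) (hff : ∀ p q, Commute (f p) (f q))
    (hhw : ∀ q, h (q + 1) • w = 0) (r n : ℕ) :
    ⁅e, coeff n (mk f ^ (r + 1))⁆ • w =
      -(((r + 1) * (n + 1)) • coeff (n + 1) (mk f ^ r) • w) := by
  have hvanish : coeff n (mk f ^ r * mk fun n => h (n + 1)) • w = 0 := by
    rw [coeff_mul, Finset.sum_smul]
    exact Finset.sum_eq_zero fun p _ => by rw [coeff_mk, mul_smul, hhw, smul_zero]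
  rw [← coeff_succ_lie_X_mul_C, lie_X_mul_C_pow_succ hef hhf hff, map_sub, coeff_succ_X_mul,
    map_nsmul, map_nsmul, coeff_eulerOp, sub_smul, smul_assoc, hvanish, smul_zero, zero_sub,
    smul_smul, smul_assoc]

theorem sum_antidiagonal_smul_eq_zero [IsAddTorsionFree M] (hef : ∀ p, ⁅e, f p⁆ = h (p + 1))
    (hhf : ∀ q p, ⁅h q, f p⁆ = (-2 : ℤ) • f (q + p)) (hff : ∀ p q, Commute (f p) (f q))
    (hew : e • w = 0) (hhw : ∀ q, h (q + 1) • w = 0) {s : ℕ} (hs : f 0 ^ (s + 2) • w = 0) :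
    ∑ p ∈ Finset.HasAntidiagonal.antidiagonal s, f p.1 • f p.2 • w = 0 := by
  have descend (r n : ℕ) (hn : coeff n (mk f ^ (r + 1)) • w = 0) :
      coeff (n + 1) (mk f ^ r) • w = 0 := by
    have key := lie_coeff_pow_succ_smul hef hhf hff hhw r n
    rw [Ring.lie_def, sub_smul, mul_smul, mul_smul, hn, hew, smul_zero, smul_zero, sub_zero,
      eq_comm, neg_eq_zero] at key
    exact (smul_eq_zero_iff_right (by positivity)).mp key
  have hcoeff (j : ℕ) (hj : j ≤ s) : coeff j (mk f ^ (s - j + 2)) • w = 0 := by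
    induction j with
    | zero => simpa using hs
    | succ j ih =>
      refine descend _ _ ?_
      rw [show s - (j + 1) + 2 + 1 = s - j + 2 by omega]
      exact ih (by omega)
  have := hcoeff s le_rfl
  rw [Nat.sub_self, zero_add, pow_two, coeff_mul, Finset.sum_smul] at this
  simpa only [coeff_mk, mul_smul] using this

end GarlandIdentity

section SimplyLaced

variable {ι R M N : Type*} [CommRing R] [CharZero R] [AddCommGroup M] [Module R M]
  [AddCommGroup N] [Module R N] {P : RootPairing ι R M N} [P.IsCrystallographic]

variable (P) in
/-- A crystallographic root pairing is simply laced if `⟨α, β^∨⟩ = ⟨β, α^∨⟩` for all roots, that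
is, if in each irreducible component all roots have the same length. -/
def IsSimplyLaced : Prop :=
  ∀ i j, P.pairingIn ℤ i j = P.pairingIn ℤ j i

theorem pairingIn_reflectionPerm_left (i j k : ι) :
    P.pairingIn ℤ (P.reflectionPerm j i) k =
      P.pairingIn ℤ i k - P.pairingIn ℤ i j * P.pairingIn ℤ j k := by
  apply FaithfulSMul.algebraMap_injective ℤ R
  rw [map_sub, map_mul, P.algebraMap_pairingIn, P.algebraMap_pairingIn, P.algebraMap_pairingIn,
    P.algebraMap_pairingIn, ← P.root_coroot_eq_pairing, P.root_reflectionPerm,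
    P.reflection_apply_root, map_sub, map_smul, LinearMap.sub_apply, LinearMap.smul_apply,
    P.root_coroot_eq_pairing, P.root_coroot_eq_pairing, smul_eq_mul]

theorem pairingIn_reflectionPerm_right (i j k : ι) :
    P.pairingIn ℤ k (P.reflectionPerm j i) =
      P.pairingIn ℤ k i - P.pairingIn ℤ k j * P.pairingIn ℤ j i := by
  apply FaithfulSMul.algebraMap_injective ℤ R
  rw [map_sub, map_mul, P.algebraMap_pairingIn, P.algebraMap_pairingIn, P.algebraMap_pairingIn,
    P.algebraMap_pairingIn, ← P.root_coroot_eq_pairing, P.coroot_reflectionPerm,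
    P.coreflection_apply_coroot, map_sub, map_smul, P.root_coroot_eq_pairing,
    P.root_coroot_eq_pairing, smul_eq_mul, mul_comm]

theorem IsSimplyLaced.pairingIn_eq_neg_one (hP : IsSimplyLaced P) {i j k : ι}
    (hk : P.root k = P.root i + P.root j) : P.pairingIn ℤ i j = -1 := by
  have hadd (l : ι) : P.pairingIn ℤ k l = P.pairingIn ℤ i l + P.pairingIn ℤ j l :=
    P.pairingIn_eq_add_of_root_eq_add hk
  have hki := hadd i
  have hkj := hadd j
  have hkk := hadd k
  rw [P.pairingIn_same] at hki hkj hkk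
  have := hP j i
  have := hP k i
  have := hP k j
  omega

theorem IsSimplyLaced.coroot_add (hP : IsSimplyLaced P) {i j k : ι}
    (hk : P.root k = P.root i + P.root j) : P.coroot k = P.coroot i + P.coroot j := by
  have hpair {i j : ι} (h : P.pairingIn ℤ i j = -1) : P.pairing i j = -1 := by
    rw [← P.algebraMap_pairingIn ℤ, h, map_neg, map_one]
  have hij := hP.pairingIn_eq_neg_one hk
  obtain rfl : k = P.reflectionPerm j i := by
    apply P.root.injective
    rw [P.root_reflectionPerm, P.reflection_apply_root, hpair hij, hk, neg_one_smul, sub_neg_eq_add]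
  rw [P.coroot_reflectionPerm, P.coreflection_apply_coroot, hpair ((hP j i).trans hij),
    neg_one_smul, sub_neg_eq_add]

section Finite

variable [Finite ι] [IsDomain R] [P.IsReduced]

theorem IsSimplyLaced.of_isSymm_cartanMatrix {b : P.Base} (hb : b.cartanMatrix.IsSymm) :
    IsSimplyLaced P := by
  have swap_simple : ∀ i, ∀ j ∈ b.support, P.pairingIn ℤ i j = P.pairingIn ℤ j i := by
    intro i
    refine b.induction_reflect i
      (p := fun i => ∀ j ∈ b.support, P.pairingIn ℤ i j = P.pairingIn ℤ j i)
      (fun i hi j hj => ?_) (fun i hi j hj => ?_) (fun i k hi hk j hj => ?_)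
    · rw [P.pairingIn_reflectionPerm_self_left, P.pairingIn_reflectionPerm_self_right, hi j hj]
    · exact hb.apply ⟨j, hj⟩ ⟨i, hi⟩
    · rw [pairingIn_reflectionPerm_left, pairingIn_reflectionPerm_right, hi j hj, hi k hk,
        show P.pairingIn ℤ k j = P.pairingIn ℤ j k from hb.apply ⟨j, hj⟩ ⟨k, hk⟩, mul_comm]
  intro i
  refine b.induction_reflect i (fun i hi j => ?_) (fun i hi j => (swap_simple j i hi).symm)
    (fun i k hi _ j => ?_)
  · rw [P.pairingIn_reflectionPerm_self_left, P.pairingIn_reflectionPerm_self_right, hi]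
  · rw [← P.pairingIn_reflectionPerm, hi, ← P.pairingIn_reflectionPerm]

theorem IsSimplyLaced.pairingIn_mem (hP : IsSimplyLaced P) {i j : ι} (hij : i ≠ j)
    (hij' : P.root i ≠ -P.root j) :
    P.pairingIn ℤ i j = -1 ∨ P.pairingIn ℤ i j = 0 ∨ P.pairingIn ℤ i j = 1 := by
  have : Module.IsReflexive R M := .of_isPerfPair P.toLinearMap
  have hmem := P.pairingIn_pairingIn_mem_set_of_isCrystal_of_isRed i j
  have hne_two := (P.pairingIn_two_two_iff ℤ i j).not.mpr hij
  have hne_neg_two := (P.pairingIn_neg_two_neg_two_iff ℤ i j).not.mpr hij'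
  rw [hP j i] at hmem hne_two hne_neg_two
  simp only [Set.mem_insert_iff, Set.mem_singleton_iff, Prod.mk.injEq] at hmem
  omega

end Finite

end SimplyLaced

section Alternating

variable {ι : Type*} [LinearOrder ι] {s : Finset ι} {d : ι → ℤ}

/-- The nonzero values of `d` on `s` are `1` and `-1` in alternation. In the theorem, `d i` is the
value of `λ₁ - λ₂` on the simple coroot `h_i`. -/
structure IsAlternatingOn (s : Finset ι) (d : ι → ℤ) : Prop where
  abs_le_one : ∀ i ∈ s, |d i| ≤ 1
  exists_between : ∀ i ∈ s, ∀ j ∈ s, i < j → d i ≠ 0 → d i = d j → ∃ k ∈ s, i < k ∧ k < j ∧ d k ≠ 0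

theorem IsAlternatingOn.of_insert {a : ι} (ha : ∀ i ∈ s, a < i)
    (hd : IsAlternatingOn (insert a s) d) : IsAlternatingOn s d where
  abs_le_one i hi := hd.abs_le_one i (Finset.mem_insert_of_mem hi)
  exists_between i hi j hj hij h0 h := by
    obtain ⟨k, hk, hik, hkj, hk0⟩ := hd.exists_between i (Finset.mem_insert_of_mem hi) j
      (Finset.mem_insert_of_mem hj) hij h0 h
    exact ⟨k, Finset.mem_of_mem_insert_of_ne hk ((ha i hi).trans hik).ne', hik, hkj, hk0⟩

theorem IsAlternatingOn.filter_of_monotone (hd : IsAlternatingOn s d) {p : ι → Prop}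
    [DecidablePred p] (hp : Monotone p) : IsAlternatingOn (s.filter p) d where
  abs_le_one i hi := hd.abs_le_one i (Finset.mem_of_mem_filter i hi)
  exists_between i hi j hj hij h0 h := by
    obtain ⟨hi, hpi⟩ := Finset.mem_filter.mp hi
    obtain ⟨k, hk, hik, hkj, hk0⟩ :=
      hd.exists_between i hi j (Finset.mem_of_mem_filter j hj) hij h0 h
    exact ⟨k, Finset.mem_filter.mpr ⟨hk, hp hik.le hpi⟩, hik, hkj, hk0⟩

theorem IsAlternatingOn.sum_eq_zero_or_eq_first (hd : IsAlternatingOn s d) :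
    ∑ i ∈ s, d i = 0 ∨
      ∃ i ∈ s, d i ≠ 0 ∧ (∀ j ∈ s, j < i → d j = 0) ∧ ∑ j ∈ s, d j = d i := by
  induction s using Finset.induction_on_min with
  | empty => exact .inl Finset.sum_empty
  | insert a s ha ih =>
    have ha' : a ∉ s := fun h => (ha a h).false
    rw [Finset.sum_insert ha']
    by_cases hda : d a = 0
    · rw [hda, zero_add]
      refine (ih (hd.of_insert ha)).imp_right ?_
      rintro ⟨i, hi, hi0, hfirst, hsum⟩
      refine ⟨i, Finset.mem_insert_of_mem hi, hi0, fun j hj hji => ?_, hsum⟩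
      rcases Finset.mem_insert.mp hj with rfl | hj
      exacts [hda, hfirst j hj hji]
    rcases ih (hd.of_insert ha) with h0 | ⟨i, hi, hi0, hfirst, hsum⟩
    · refine .inr ⟨a, Finset.mem_insert_self a s, hda, fun j hj hja => ?_, by rw [h0, add_zero]⟩
      rcases Finset.mem_insert.mp hj with rfl | hj
      exacts [(hja.false).elim, ((ha j hj).asymm hja).elim]
    · left
      have hne : d a ≠ d i := fun h => by
        obtain ⟨k, hk, hak, hki, hk0⟩ := hd.exists_between a (Finset.mem_insert_self a s) i
          (Finset.mem_insert_of_mem hi) (ha i hi) hda h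
        exact hk0 (hfirst k (Finset.mem_of_mem_insert_of_ne hk hak.ne') hki)
      have hda1 := abs_le.mp (hd.abs_le_one a (Finset.mem_insert_self a s))
      have hdi1 := abs_le.mp (hd.abs_le_one i (Finset.mem_insert_of_mem hi))
      omega

theorem IsAlternatingOn.abs_sum_le_one (hd : IsAlternatingOn s d) : |∑ i ∈ s, d i| ≤ 1 := by
  rcases hd.sum_eq_zero_or_eq_first with h | ⟨i, hi, -, -, h⟩
  · simp [h]
  · exact h ▸ hd.abs_le_one i hi

end Alternating

section TailSum

variable {n : ℕ} {s : Finset (Fin n)} {d : Fin n → ℤ}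

/-- The sum of `d k` over the `k ≥ l` in `s`. It is the potential whose successive differences are
the values of `d` on `s`. -/
def tailSum (s : Finset (Fin n)) (d : Fin n → ℤ) (l : ℕ) : ℤ :=
  ∑ k ∈ s with l ≤ k.val, d k

theorem IsAlternatingOn.abs_tailSum_le_one (hd : IsAlternatingOn s d) (l : ℕ) :
    |tailSum s d l| ≤ 1 :=
  (hd.filter_of_monotone fun _ _ hij hl => hl.trans hij).abs_sum_le_one

theorem tailSum_eq_zero {l : ℕ} (hl : ∀ k ∈ s, k.val < l) : tailSum s d l = 0 :=
  Finset.sum_eq_zero fun k hk => by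
    have := hl k (Finset.mem_of_mem_filter k hk)
    have := (Finset.mem_filter.mp hk).2
    omega

theorem tailSum_eq_ite_add_tailSum_succ (i : Fin n) :
    tailSum s d i = (if i ∈ s then d i else 0) + tailSum s d (i + 1) := by
  have hlt : (s.filter fun k => i.val ≤ k.val).erase i = s.filter fun k => i.val + 1 ≤ k.val := by
    ext k
    simp only [Finset.mem_erase, Finset.mem_filter, ne_eq, Fin.ext_iff]
    grind
  rw [tailSum, tailSum, ← hlt]
  split_ifs with hi
  · exact (Finset.add_sum_erase _ _ (Finset.mem_filter.mpr ⟨hi, le_rfl⟩)).symm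
  · rw [zero_add, Finset.erase_eq_of_notMem fun h => hi (Finset.mem_of_mem_filter i h)]

end TailSum

section Realization

variable {n : ℕ}

/-- The simple roots `ε_i - ε_{i+1}` of type `A_n` in `ℤ^{n+1}`. -/
def simpleRootA (i : Fin n) : Fin (n + 1) → ℤ :=
  Pi.single i.castSucc 1 - Pi.single i.succ 1

/-- The simple roots `ε_i - ε_{i+1}` and `ε_{n+1} + ε_{n+2}` of type `D_{n+2}` in `ℤ^{n+2}`. -/
def simpleRootD (i : Fin (n + 2)) : Fin (n + 2) → ℤ :=
  Fin.lastCases (Pi.single (Fin.last n).castSucc 1 + Pi.single (Fin.last (n + 1)) 1) simpleRootA i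

theorem cartanMatrix_A_eq_dotProduct (i j : Fin n) :
    CartanMatrix.A n i j = simpleRootA i ⬝ᵥ simpleRootA j := by
  simp only [simpleRootA, sub_dotProduct, single_one_dotProduct, Pi.sub_apply, Pi.single_apply,
    CartanMatrix.A, Matrix.of_apply, Fin.ext_iff, Fin.val_castSucc, Fin.val_succ]
  split_ifs <;> omega

theorem cartanMatrix_D_eq_dotProduct (i j : Fin (n + 2)) :
    CartanMatrix.D (n + 2) i j = simpleRootD i ⬝ᵥ simpleRootD j := by
  induction i using Fin.lastCases <;> induction j using Fin.lastCases <;>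
    simp only [simpleRootD, Fin.lastCases_last, Fin.lastCases_castSucc, simpleRootA,
      add_dotProduct, sub_dotProduct, single_one_dotProduct, Pi.add_apply, Pi.sub_apply,
      Pi.single_apply, CartanMatrix.D, Matrix.of_apply, Fin.ext_iff, Fin.val_castSucc,
      Fin.val_succ, Fin.val_last, or_true, and_true] <;>
    split_ifs <;> omega

theorem exists_potential_A {d : Fin (n + 1) → ℤ} (hlast : |d (Fin.last n)| ≤ 1)
    (hd : IsAlternatingOn (Finset.univ.erase (Fin.last n)) d) :
    ∃ E : Fin (n + 2) → ℤ, (∀ i, simpleRootA i ⬝ᵥ E = 2 * d i) ∧ ∀ l, |E l| ≤ 2 := by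
  let T := tailSum (Finset.univ.erase (Fin.last n)) d
  have hT_last : T n = 0 := tailSum_eq_zero fun k hk => Fin.val_lt_last (Finset.ne_of_mem_erase hk)
  have hT_cast (i : Fin n) : T i = d i.castSucc + T (i + 1) := by
    have h := tailSum_eq_ite_add_tailSum_succ (s := Finset.univ.erase (Fin.last n)) (d := d)
      i.castSucc
    rwa [if_pos (by simp [i.castSucc_ne_last])] at h
  refine ⟨Fin.snoc (α := fun _ => ℤ) (fun l => 2 * T l) (-2 * d (Fin.last n)),
    fun i => ?_, fun l => ?_⟩
  · rw [simpleRootA, sub_dotProduct, single_one_dotProduct, single_one_dotProduct,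
      Fin.snoc_castSucc]
    induction i using Fin.lastCases with
    | last => rw [Fin.succ_last, Fin.snoc_last, Fin.val_last, hT_last]; ring
    | cast i =>
      rw [Fin.succ_castSucc, Fin.snoc_castSucc, Fin.val_succ, Fin.val_castSucc, hT_cast]
      ring
  · induction l using Fin.lastCases with
    | last => rw [Fin.snoc_last]; rw [abs_le] at hlast ⊢; constructor <;> linarith
    | cast l =>
      have := abs_le.mp (hd.abs_tailSum_le_one l)
      rw [Fin.snoc_castSucc, abs_le]; constructor <;> linarith

theorem simpleRootD_dotProduct_of_castSucc_eq {E c : Fin (n + 2) → ℤ}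
    (hE : ∀ i : Fin (n + 1), E i.castSucc = E i.succ + c i.castSucc)
    (hlast : 2 * E (Fin.last (n + 1)) = c (Fin.last (n + 1)) - c (Fin.last n).castSucc)
    (i : Fin (n + 2)) : simpleRootD i ⬝ᵥ E = c i := by
  induction i using Fin.lastCases with
  | last =>
    rw [simpleRootD, Fin.lastCases_last, add_dotProduct, single_one_dotProduct,
      single_one_dotProduct, hE, Fin.succ_last]
    linear_combination hlast
  | cast i =>
    rw [simpleRootD, Fin.lastCases_castSucc, simpleRootA, sub_dotProduct, single_one_dotProduct,
      single_one_dotProduct, hE, add_sub_cancel_left]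

theorem exists_potential_D {d : Fin (n + 2) → ℤ}
    (hp : IsAlternatingOn (Finset.univ.erase (Fin.last n).castSucc) d)
    (hq : IsAlternatingOn (Finset.univ.erase (Fin.last (n + 1))) d) :
    ∃ E : Fin (n + 2) → ℤ, (∀ i, simpleRootD i ⬝ᵥ E = 2 * d i) ∧ ∀ l, |E l| ≤ 2 := by
  set p := (Fin.last n).castSucc
  set q := Fin.last (n + 1)
  have hqp : q ≠ p := (Fin.last n).castSucc_ne_last.symm
  let T (t : Fin (n + 2)) : ℕ → ℤ := tailSum (Finset.univ.erase t) d
  have hT (t i : Fin (n + 2)) : T t i = (if i ≠ t then d i else 0) + T t (i + 1) := by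
    simpa using tailSum_eq_ite_add_tailSum_succ (s := Finset.univ.erase t) (d := d) i
  have hT_end (t : Fin (n + 2)) : T t (q + 1) = 0 := tailSum_eq_zero fun k _ => k.2
  -- The spin nodes `p` and `q` play symmetric roles: each of the two tail sums omits one of them.
  let E : Fin (n + 2) → ℤ := fun l => T p l + T q l - if l = q then d p else 0
  have hE_q : E q = d q - d p := by
    simp only [E, hT _ q, hT_end, if_pos hqp, ne_eq, not_true_eq_false, if_true, if_false]
    ring
  have hE_castSucc (i : Fin (n + 1)) : E i.castSucc = E i.succ + 2 * d i.castSucc := by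
    have hiq : i.castSucc ≠ q := i.castSucc_ne_last
    have hip : i.castSucc = p ↔ i.succ = q := by
      simp only [p, q, Fin.ext_iff, Fin.val_castSucc, Fin.val_succ, Fin.val_last, add_left_inj]
    have hTi (t : Fin (n + 2)) := hT t i.castSucc
    simp only [Fin.val_castSucc] at hTi
    simp only [E, Fin.val_castSucc, Fin.val_succ, hTi, if_neg hiq, if_pos hiq, ne_eq, hip, ite_not]
    split_ifs with h
    · rw [hip.mpr h]; ring
    · ring
  refine ⟨E, simpleRootD_dotProduct_of_castSucc_eq (c := fun i => 2 * d i) hE_castSucc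
    (by rw [hE_q]; ring), fun l => ?_⟩
  by_cases hl : l = q
  · have hdp := abs_le.mp (hq.abs_le_one p (by simp [hqp.symm]))
    have hdq := abs_le.mp (hp.abs_le_one q (by simp [hqp]))
    rw [hl, hE_q, abs_le]; constructor <;> linarith
  · have hTp := abs_le.mp (hp.abs_tailSum_le_one l)
    have hTq := abs_le.mp (hq.abs_tailSum_le_one l)
    simp only [E, if_neg hl, abs_le]; constructor <;> linarith

end Realization

open LieAlgebra LieAlgebra.IsKilling

section Interlacing

variable {n : ℕ} {a c : Fin n → ℤ}

theorem HalfInterlacing.exists_between (hac : HalfInterlacing a c) (ha : ∀ i, 0 ≤ a i)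
    (hc : ∀ i, 0 ≤ c i) {t : Fin n} (ht : n ≤ t.val + 2) {i j : Fin n} (hit : i ≠ t) (hjt : j ≠ t)
    (hij : i < j) (hai : a i = 1) (haj : a j = 1) :
    ∃ k, k ≠ t ∧ i < k ∧ k < j ∧ c k = 1 := by
  obtain ⟨k, hik, hkj, hck⟩ := hac.between i j hij
    (fun h => by rw [ne_eq, Fin.ext_iff] at hit hjt; omega) hai haj
  refine ⟨k, ?_, hik, hkj, hck⟩
  rintro rfl
  have hlast := hac.last k j (by omega) (by omega) (by have := ha k; omega)
  have := hc j
  omega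

theorem HalfInterlacing.isAlternatingOn_sub (hac : HalfInterlacing a c) (hca : HalfInterlacing c a)
    (ha : ∀ i, 0 ≤ a i) (hc : ∀ i, 0 ≤ c i) (hle : ∀ i, a i + c i ≤ 1) {t : Fin n}
    (ht : n ≤ t.val + 2) : IsAlternatingOn (Finset.univ.erase t) fun i => a i - c i where
  abs_le_one i _ := by
    have := ha i; have := hc i; have := hle i
    rw [abs_le]; omega
  exists_between i hi j hj hij h0 heq := by
    have hit := Finset.ne_of_mem_erase hi
    have hjt := Finset.ne_of_mem_erase hj
    have hi' := And.intro (ha i) (And.intro (hc i) (hle i))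
    have hj' := And.intro (ha j) (And.intro (hc j) (hle j))
    rcases (show a i = 1 ∧ a j = 1 ∨ c i = 1 ∧ c j = 1 by omega) with ⟨hai, haj⟩ | ⟨hci, hcj⟩
    · obtain ⟨k, hkt, hik, hkj, hck⟩ := hac.exists_between ha hc ht hit hjt hij hai haj
      have := ha k; have := hle k
      exact ⟨k, by simp [hkt], hik, hkj, by omega⟩
    · obtain ⟨k, hkt, hik, hkj, hak⟩ := hca.exists_between hc ha ht hit hjt hij hci hcj
      have := hc k; have := hle k
      exact ⟨k, by simp [hkt], hik, hkj, by omega⟩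

end Interlacing

theorem abs_dotProduct_le {κ : Type*} [Fintype κ] {u E : κ → ℤ} {c : ℤ} (hE : ∀ l, |E l| ≤ c) :
    |u ⬝ᵥ E| ≤ c * (u ⬝ᵥ u) := by
  rw [dotProduct, dotProduct, Finset.mul_sum]
  refine (Finset.abs_sum_le_sum_abs _ _).trans (Finset.sum_le_sum fun l _ => ?_)
  have hu : |u l| ≤ u l * u l := by
    rw [← sq, Int.abs_eq_natAbs]
    exact Int.natAbs_le_self_sq _
  calc |u l * E l| = |u l| * |E l| := abs_mul _ _
    _ ≤ (u l * u l) * c := mul_le_mul hu (hE l) (abs_nonneg _) (mul_self_nonneg _)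
    _ = c * (u l * u l) := mul_comm _ _

theorem IsSimplyLaced.abs_le_of_gram {ι R M N : Type*} [Finite ι] [CommRing R] [CharZero R]
    [IsDomain R] [AddCommGroup M] [Module R M] [AddCommGroup N] [Module R N]
    {P : RootPairing ι R M N} [P.IsCrystallographic] (hP : IsSimplyLaced P)
    {b : P.Base} {κ : Type*} [Fintype κ] {v : b.support → κ → ℤ}
    (hv : ∀ i j, b.cartanMatrix i j = v i ⬝ᵥ v j) {f : ι → ℤ} {E : κ → ℤ} {c : ℤ}
    (hf : ∀ i j k, P.root k = P.root i + P.root j → f k = f i + f j)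
    (hvE : ∀ i : b.support, v i ⬝ᵥ E = f i) (hE : ∀ l, |E l| ≤ c) {α : ι} (hα : b.IsPos α) :
    |f α| ≤ c * 2 := by
  have hv' : ∀ i j : b.support, P.pairingIn ℤ i j = v i ⬝ᵥ v j := hv
  -- Each positive root is realized by a vector of square length `2`, on which `f` is `· ⬝ᵥ E`.
  suffices ∃ u : κ → ℤ, u ⬝ᵥ u = 2 ∧ (∀ j : b.support, P.pairingIn ℤ α j = u ⬝ᵥ v j) ∧
      u ⬝ᵥ E = f α by
    obtain ⟨u, hu, -, huE⟩ := this
    exact huE ▸ hu ▸ abs_dotProduct_le hE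
  refine hα.induction_on_add (p := fun α => ∃ u : κ → ℤ, u ⬝ᵥ u = 2 ∧
    (∀ j : b.support, P.pairingIn ℤ α j = u ⬝ᵥ v j) ∧ u ⬝ᵥ E = f α)
    (fun i hi => ⟨v ⟨i, hi⟩, ?_, hv' ⟨i, hi⟩, hvE ⟨i, hi⟩⟩) ?_
  · rw [← hv', P.pairingIn_same]
  · rintro i j k hk ⟨u, hu, huv, huE⟩ hj
    have huj : u ⬝ᵥ v ⟨j, hj⟩ = -1 := by rw [← huv ⟨j, hj⟩, hP.pairingIn_eq_neg_one hk]
    have hjj : v ⟨j, hj⟩ ⬝ᵥ v ⟨j, hj⟩ = 2 := by rw [← hv', P.pairingIn_same]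
    refine ⟨u + v ⟨j, hj⟩, ?_, fun l => ?_, ?_⟩
    · rw [add_dotProduct, dotProduct_add, dotProduct_add, dotProduct_comm (v ⟨j, hj⟩) u, hu, huj,
        hjj]
      norm_num
    · rw [P.pairingIn_eq_add_of_root_eq_add hk, huv, hv' ⟨j, hj⟩, add_dotProduct]
    · rw [add_dotProduct, huE, hvE, hf i j k hk]

section Weights

variable {𝔤 : Type*} [LieRing 𝔤] [LieAlgebra ℂ 𝔤] [FiniteDimensional ℂ 𝔤] [IsKilling ℂ 𝔤]
  {H : LieSubalgebra ℂ 𝔤} [H.IsCartanSubalgebra]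

section Values

theorem value_add (lam mu : weightLattice H) (α : H.root) :
    value (lam + mu) α = value lam α + value mu α := by
  have h := value_spec (lam + mu) α
  rw [AddSubgroup.coe_add, LinearMap.add_apply, value_spec, value_spec] at h
  exact_mod_cast h.symm

theorem value_sub (lam mu : weightLattice H) (α : H.root) :
    value (lam - mu) α = value lam α - value mu α := by
  rw [eq_sub_iff_add_eq, ← value_add, sub_add_cancel]

theorem value_rootWeight (β α : H.root) :
    value (rootWeight β) α = (rootSystem H).pairingIn ℤ β α := by
  have h := value_spec (rootWeight β) α
  have hpairing := (rootSystem H).algebraMap_pairingIn ℤ β α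
  rw [rootSystem_pairing_apply] at hpairing
  change β.1 (coroot α.1) = _ at h
  rw [← hpairing, eq_intCast] at h
  exact_mod_cast h.symm

theorem value_of_root_add (hs : IsSimplyLaced (rootSystem H)) (lam : weightLattice H)
    {α β γ : H.root}
    (hγ : (rootSystem H).root γ = (rootSystem H).root α + (rootSystem H).root β) :
    value lam γ = value lam α + value lam β := by
  have h := value_spec lam γ
  have hcoroot := hs.coroot_add hγ
  simp only [rootSystem_coroot_apply] at hcoroot
  rw [hcoroot, map_add, value_spec, value_spec] at h
  exact_mod_cast h.symm

variable {b : (rootSystem H).Base} {lam mu : weightLattice H}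

theorem IsDominant.add (hlam : IsDominant b lam) (hmu : IsDominant b mu) :
    IsDominant b (lam + mu) := fun i hi => by
  rw [value_add]
  exact add_nonneg (hlam i hi) (hmu i hi)

theorem IsDominant.value_nonneg (hs : IsSimplyLaced (rootSystem H)) (hlam : IsDominant b lam)
    {α : H.root} (hα : b.IsPos α) : 0 ≤ value lam α := by
  refine hα.induction_on_add (p := fun α => 0 ≤ value lam α) hlam fun i j k hk hi hj => ?_
  rw [value_of_root_add hs lam hk]
  exact add_nonneg hi (hlam j hj)

end Values

section TypeAD

variable {b : (rootSystem H).Base} {n : ℕ} {e : Fin n ≃ b.support}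

theorem IsTypeAD.isSimplyLaced (htype : IsTypeAD b e) : IsSimplyLaced (rootSystem H) := by
  refine .of_isSymm_cartanMatrix (b := b) (Matrix.IsSymm.ext fun i j => ?_)
  rw [← e.apply_symm_apply i, ← e.apply_symm_apply j]
  rcases htype with ⟨-, hC⟩ | ⟨-, hC⟩
  · rw [hC, hC, (CartanMatrix.A_isSymm n).apply]
  · rw [hC, hC, (CartanMatrix.D_isSymm n).apply]

theorem IsInterlacing.isAlternatingOn_value_sub {lam₁ lam₂ : weightLattice H}
    (h₁ : IsDominant b lam₁) (h₂ : IsDominant b lam₂) (hint : IsInterlacing e lam₁ lam₂)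
    {t : Fin n} (ht : n ≤ t.val + 2) :
    IsAlternatingOn (Finset.univ.erase t) fun i => value (lam₁ - lam₂) (e i) := by
  simp only [value_sub]
  exact hint.left.isAlternatingOn_sub hint.right (fun i => h₁ _ (e i).2) (fun i => h₂ _ (e i).2)
    (fun i => by rw [← value_add]; exact hint.sum_le_one i) ht

theorem IsInterlacing.abs_value_sub_le_one {lam₁ lam₂ : weightLattice H}
    (h₁ : IsDominant b lam₁) (h₂ : IsDominant b lam₂) (hint : IsInterlacing e lam₁ lam₂)
    (i : Fin n) : |value (lam₁ - lam₂) (e i)| ≤ 1 := by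
  have hle := hint.sum_le_one i
  have hlam₁ := h₁ _ (e i).2
  have hlam₂ := h₂ _ (e i).2
  rw [value_add] at hle
  rw [value_sub, abs_le]
  constructor <;> linarith

theorem IsInterlacing.exists_realization {lam₁ lam₂ : weightLattice H} (htype : IsTypeAD b e)
    (h₁ : IsDominant b lam₁) (h₂ : IsDominant b lam₂) (hint : IsInterlacing e lam₁ lam₂) :
    ∃ (m : ℕ) (v : Fin n → Fin m → ℤ) (E : Fin m → ℤ),
      (∀ i j, b.cartanMatrix (e i) (e j) = v i ⬝ᵥ v j) ∧
      (∀ i, v i ⬝ᵥ E = 2 * value (lam₁ - lam₂) (e i)) ∧ ∀ l, |E l| ≤ 2 := by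
  rcases htype with ⟨hn, hC⟩ | ⟨hn, hC⟩
  · obtain ⟨n, rfl⟩ := Nat.exists_eq_add_of_le' hn
    obtain ⟨E, hvE, hE⟩ := exists_potential_A (d := fun i => value (lam₁ - lam₂) (e i))
      (hint.abs_value_sub_le_one h₁ h₂ _) (hint.isAlternatingOn_value_sub h₁ h₂ (by simp))
    exact ⟨_, simpleRootA, E, fun i j => by rw [hC, cartanMatrix_A_eq_dotProduct], hvE, hE⟩
  · obtain ⟨n, rfl⟩ := Nat.exists_eq_add_of_le' (le_trans (by norm_num : 2 ≤ 4) hn)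
    obtain ⟨E, hvE, hE⟩ := exists_potential_D (d := fun i => value (lam₁ - lam₂) (e i))
      (hint.isAlternatingOn_value_sub h₁ h₂ (by simp))
      (hint.isAlternatingOn_value_sub h₁ h₂ (by simp))
    exact ⟨_, simpleRootD, E, fun i j => by rw [hC, cartanMatrix_D_eq_dotProduct], hvE, hE⟩

theorem IsInterlacing.abs_value_sub_le_two {lam₁ lam₂ : weightLattice H} (htype : IsTypeAD b e)
    (h₁ : IsDominant b lam₁) (h₂ : IsDominant b lam₂) (hint : IsInterlacing e lam₁ lam₂)
    {α : H.root} (hα : b.IsPos α) : |value (lam₁ - lam₂) α| ≤ 2 := by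
  obtain ⟨m, v, E, hgram, hvE, hE⟩ := hint.exists_realization htype h₁ h₂
  have hs := htype.isSimplyLaced
  have h := hs.abs_le_of_gram (v := fun i => v (e.symm i)) (f := fun α => 2 * value (lam₁ - lam₂) α)
    (fun i j => by rw [← hgram, e.apply_symm_apply, e.apply_symm_apply])
    (fun i j k hk => by rw [value_of_root_add hs _ hk, mul_add])
    (fun i => by rw [hvE, e.apply_symm_apply]) hE hα
  rw [abs_mul, abs_two] at h
  linarith

end TypeAD

end Weights

section RootSpaces

theorem eq_zero_or_exists_root {𝔤 : Type*} [LieRing 𝔤] [LieAlgebra ℂ 𝔤] [FiniteDimensional ℂ 𝔤]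
    {H : LieSubalgebra ℂ 𝔤} [H.IsCartanSubalgebra] {χ : H → ℂ} (hχ : χ ≠ 0) {x : 𝔤}
    (hx : x ∈ rootSpace H χ) : x = 0 ∨ ∃ γ : H.root, (γ.1 : H → ℂ) = χ := by
  by_cases h : rootSpace H χ = ⊥
  · exact .inl (by simpa [h] using hx)
  · refine .inr ⟨⟨⟨χ, h⟩, ?_⟩, rfl⟩
    simpa [LieModule.Weight.IsNonZero, LieModule.Weight.IsZero] using hχ

variable {𝔤 : Type*} [LieRing 𝔤] [LieAlgebra ℂ 𝔤] [FiniteDimensional ℂ 𝔤] [IsKilling ℂ 𝔤]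
  {H : LieSubalgebra ℂ 𝔤} [H.IsCartanSubalgebra] {α β γ : H.root} {x y z : 𝔤}

theorem root_eq_add_iff : (rootSystem H).root γ = (rootSystem H).root α + (rootSystem H).root β ↔
    (γ.1 : H → ℂ) = (α.1 : H → ℂ) + (β.1 : H → ℂ) :=
  DFunLike.ext'_iff

theorem coe_reflectionPerm_self (α : H.root) :
    (((rootSystem H).reflectionPerm α α).1 : H → ℂ) = -(α.1 : H → ℂ) := by
  have h := (rootSystem H).root_reflectionPerm α α
  rw [(rootSystem H).reflection_apply_self] at h
  exact DFunLike.ext'_iff.mp h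

theorem exists_ne_zero_mem_rootSpace_neg (α : H.root) :
    ∃ x ∈ rootSpace H (-(α.1 : H → ℂ)), x ≠ 0 := by
  obtain ⟨x, hx, hx0⟩ := (-α.1).exists_ne_zero
  exact ⟨x, by simpa using hx, hx0⟩

theorem exists_eq_smul_of_mem_rootSpace_neg (hx : x ∈ rootSpace H (-(α.1 : H → ℂ)))
    (hy : y ∈ rootSpace H (-(α.1 : H → ℂ))) (hx0 : x ≠ 0) : ∃ c : ℂ, y = c • x := by
  rw [← LieModule.Weight.coe_neg] at hx hy
  have hrank := finrank_rootSpace_eq_one (-α.1) (H.isNonZero_coe_root α).neg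
  obtain ⟨c, hc⟩ := (finrank_eq_one_iff_of_nonzero' (⟨x, hx⟩ : rootSpace H (-α.1))
    (by simpa [Subtype.ext_iff] using hx0)).mp hrank ⟨y, hy⟩
  exact ⟨c, (congrArg Subtype.val hc).symm⟩

theorem lie_eq_neg_smul_of_mem_rootSpace_neg (hx : x ∈ rootSpace H (-(α.1 : H → ℂ))) (h : H) :
    ⁅(h : 𝔤), x⁆ = -(α.1 h) • x :=
  lie_eq_smul_of_mem_rootSpace hx h

theorem coroot_lie_eq (β : H.root) (hx : x ∈ rootSpace H (-(α.1 : H → ℂ))) :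
    ⁅((coroot β.1 : H) : 𝔤), x⁆ = -(rootSystem H).pairingIn ℤ α β • x := by
  rw [lie_eq_neg_smul_of_mem_rootSpace_neg hx, ← rootSystem_pairing_apply,
    ← (rootSystem H).algebraMap_pairingIn ℤ, algebraMap_int_eq, eq_intCast, ← Int.cast_neg,
    Int.cast_smul_eq_zsmul]

theorem exists_lie_eq_coroot (hx : x ∈ rootSpace H (-(α.1 : H → ℂ))) (hx0 : x ≠ 0) :
    ∃ e ∈ rootSpace H (α.1 : H → ℂ), ⁅e, x⁆ = (coroot α.1 : H) := by
  obtain ⟨h, e, f, ht, he, hf⟩ := exists_isSl2Triple_of_weight_isNonZero (H.isNonZero_coe_root α)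
  obtain ⟨c, rfl⟩ := exists_eq_smul_of_mem_rootSpace_neg hx hf hx0
  refine ⟨c • e, Submodule.smul_mem _ c he, ?_⟩
  rw [smul_lie, ← lie_smul, ht.lie_e_f, ht.h_eq_coroot (H.isNonZero_coe_root α) he hf]

theorem lie_mem_rootSpace_neg
    (hγ : (rootSystem H).root γ = (rootSystem H).root α + (rootSystem H).root β)
    (hx : x ∈ rootSpace H (-(α.1 : H → ℂ))) (hy : y ∈ rootSpace H (-(β.1 : H → ℂ))) :
    ⁅x, y⁆ ∈ rootSpace H (-(γ.1 : H → ℂ)) := by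
  rw [root_eq_add_iff.mp hγ, neg_add]
  exact lie_mem_genWeightSpace_of_mem_genWeightSpace hx hy

theorem lie_eq_zero_of_forall_root_ne
    (h : ∀ γ, (rootSystem H).root γ ≠ (rootSystem H).root α + (rootSystem H).root β)
    (h' : (rootSystem H).root α ≠ -(rootSystem H).root β)
    (hx : x ∈ rootSpace H (-(α.1 : H → ℂ))) (hy : y ∈ rootSpace H (-(β.1 : H → ℂ))) :
    ⁅x, y⁆ = 0 := by
  have hxy := lie_mem_genWeightSpace_of_mem_genWeightSpace hx hy
  have hχ : -(α.1 : H → ℂ) + -(β.1 : H → ℂ) ≠ 0 := fun h0 =>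
    h' (DFunLike.ext'_iff.mpr (by simpa using (neg_eq_of_add_eq_zero_right h0)))
  refine (eq_zero_or_exists_root hχ hxy).resolve_right ?_
  rintro ⟨γ, hγ⟩
  refine h ((rootSystem H).reflectionPerm γ γ) (root_eq_add_iff.mpr ?_)
  rw [coe_reflectionPerm_self, hγ, neg_add, neg_neg, neg_neg]

section SimplyLaced

variable (hs : IsSimplyLaced (rootSystem H))
include hs

theorem lie_eq_zero_of_pairingIn_nonneg (h : 0 ≤ (rootSystem H).pairingIn ℤ α β)
    (hx : x ∈ rootSpace H (-(α.1 : H → ℂ))) (hy : y ∈ rootSpace H (-(β.1 : H → ℂ))) :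
    ⁅x, y⁆ = 0 := by
  refine lie_eq_zero_of_forall_root_ne (fun γ hγ => ?_) (fun hαβ => ?_) hx hy
  · rw [hs.pairingIn_eq_neg_one hγ] at h
    omega
  · rw [((rootSystem H).pairingIn_neg_two_neg_two_iff ℤ α β).mpr hαβ |>.1] at h
    omega

variable (hγ : (rootSystem H).root γ = (rootSystem H).root α + (rootSystem H).root β)
include hγ

theorem lie_ne_zero_of_root_eq_add (hx : x ∈ rootSpace H (-(α.1 : H → ℂ)))
    (hy : y ∈ rootSpace H (-(β.1 : H → ℂ))) (hx0 : x ≠ 0) (hy0 : y ≠ 0) : ⁅x, y⁆ ≠ 0 := by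
  intro h0
  -- `x` would be a primitive vector of weight `-1` for the `𝔰𝔩₂`-triple of `-β`
  obtain ⟨h, e, f, ht, he, hf⟩ := exists_isSl2Triple_of_weight_isNonZero (H.isNonZero_coe_root β)
  obtain ⟨c, hc⟩ := exists_eq_smul_of_mem_rootSpace_neg hy hf hy0
  have primitive : ht.symm.HasPrimitiveVectorWith x (-1 : ℂ) :=
    { ne_zero := hx0
      lie_h := by
        rw [neg_lie, ht.h_eq_coroot (H.isNonZero_coe_root β) he hf, coroot_lie_eq β hx,
          hs.pairingIn_eq_neg_one hγ]
        simp
      lie_e := by rw [hc, smul_lie, ← lie_skew, h0, neg_zero, smul_zero] }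
  obtain ⟨n, hn⟩ := primitive.exists_nat
  have : ((n + 1 : ℕ) : ℂ) = 0 := by rw [Nat.cast_add, ← hn]; simp
  exact Nat.cast_ne_zero.mpr n.succ_ne_zero this

theorem exists_eq_smul_lie_of_root_eq_add (hx : x ∈ rootSpace H (-(α.1 : H → ℂ)))
    (hy : y ∈ rootSpace H (-(β.1 : H → ℂ))) (hx0 : x ≠ 0) (hy0 : y ≠ 0)
    (hz : z ∈ rootSpace H (-(γ.1 : H → ℂ))) : ∃ c : ℂ, z = c • ⁅x, y⁆ :=
  exists_eq_smul_of_mem_rootSpace_neg (lie_mem_rootSpace_neg hγ hx hy) hz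
    (lie_ne_zero_of_root_eq_add hs hγ hx hy hx0 hy0)

theorem lie_lie_eq_zero_left (hx : x ∈ rootSpace H (-(α.1 : H → ℂ)))
    (hy : y ∈ rootSpace H (-(β.1 : H → ℂ))) : ⁅x, ⁅x, y⁆⁆ = 0 := by
  refine lie_eq_zero_of_pairingIn_nonneg hs ?_ hx (lie_mem_rootSpace_neg hγ hx hy)
  rw [hs, (rootSystem H).pairingIn_eq_add_of_root_eq_add hγ, (rootSystem H).pairingIn_same, hs,
    hs.pairingIn_eq_neg_one hγ]
  norm_num

theorem lie_lie_eq_zero_right (hx : x ∈ rootSpace H (-(α.1 : H → ℂ)))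
    (hy : y ∈ rootSpace H (-(β.1 : H → ℂ))) : ⁅y, ⁅x, y⁆⁆ = 0 := by
  rw [← lie_skew x y, lie_neg, lie_lie_eq_zero_left hs (by rw [hγ, add_comm]) hy hx, neg_zero]

end SimplyLaced

end RootSpaces

theorem isAddTorsionFree_of_algebra (K A M : Type*) [Field K] [CharZero K] [Ring A] [Algebra K A]
    [AddCommGroup M] [Module A M] : IsAddTorsionFree M :=
  let _ : Module ℚ M := Module.compHom M ((algebraMap K A).comp (algebraMap ℚ K))
  .of_module_rat M

section CurrentElements

variable {𝔤 : Type*} [LieRing 𝔤] [LieAlgebra ℂ 𝔤]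

theorem cur_zero (r : ℕ) : cur (0 : 𝔤) r = 0 := by
  simp [cur]

theorem cur_smul (c : ℂ) (x : 𝔤) (r : ℕ) : cur (c • x) r = c • cur x r := by
  simp [cur]

theorem cur_zsmul (z : ℤ) (x : 𝔤) (r : ℕ) : cur (z • x) r = z • cur x r := by
  rw [← Int.cast_smul_eq_zsmul ℂ, cur_smul, Int.cast_smul_eq_zsmul]

theorem lie_cur_cur (x y : 𝔤) (r s : ℕ) : ⁅cur x r, cur y s⁆ = cur ⁅x, y⁆ (r + s) := by
  let _ : LieRing (UCurrent 𝔤) := LieRing.ofAssociativeRing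
  have h := (UniversalEnvelopingAlgebra.ι ℂ).map_lie
    (((Polynomial.X : ℂ[X]) ^ r) ⊗ₜ[ℂ] x) (((Polynomial.X : ℂ[X]) ^ s) ⊗ₜ[ℂ] y)
  rw [LieAlgebra.ExtendScalars.bracket_tmul, ← pow_add] at h
  exact h.symm

theorem commute_cur_of_lie_eq_zero {x y : 𝔤} (h : ⁅x, y⁆ = 0) (r s : ℕ) :
    Commute (cur x r) (cur y s) := by
  rw [commute_iff_lie_eq, lie_cur_cur, h, cur_zero]

theorem iterate_lie_cur_zero (x y : 𝔤) (r k : ℕ) :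
    (⁅cur x 0, ·⁆)^[k] (cur y r) = cur ((ad ℂ 𝔤 x ^ k) y) r := by
  induction k with
  | zero => rfl
  | succ k ih =>
    rw [Function.iterate_succ_apply', ih, lie_cur_cur, zero_add, pow_succ', Module.End.mul_apply,
      ad_apply]

theorem ucurrent_induction {p : UCurrent 𝔤 → Prop}
    (algebraMap : ∀ c : ℂ, p (algebraMap ℂ _ c)) (cur : ∀ (x : 𝔤) (r : ℕ), p (cur x r))
    (add : ∀ u v, p u → p v → p (u + v)) (mul : ∀ u v, p u → p v → p (u * v))
    (u : UCurrent 𝔤) : p u := by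
  have hι : ∀ z : Current 𝔤, p (UniversalEnvelopingAlgebra.ι ℂ z) := by
    intro z
    induction z using TensorProduct.induction_on with
    | zero => simpa using algebraMap 0
    | add a c ha hc => rw [map_add]; exact add _ _ ha hc
    | tmul f x =>
      induction f using Polynomial.induction_on' with
      | add f g hf hg => rw [TensorProduct.add_tmul, map_add]; exact add _ _ hf hg
      | monomial n a =>
        rw [← Polynomial.C_mul_X_pow_eq_monomial, ← Polynomial.smul_eq_C_mul,
          ← TensorProduct.smul_tmul', map_smul, Algebra.smul_def]
        exact mul _ _ (algebraMap a) (cur x n)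
  obtain ⟨t, rfl⟩ : ∃ t, UniversalEnvelopingAlgebra.mkAlgHom ℂ (Current 𝔤) t = u :=
    RingCon.mkₐ_surjective (α := ℂ) _ u
  induction t using TensorAlgebra.induction with
  | algebraMap c => rw [AlgHom.commutes]; exact algebraMap c
  | ι z => exact hι z
  | mul a c ha hc => rw [map_mul]; exact mul _ _ ha hc
  | add a c ha hc => rw [map_add]; exact add _ _ ha hc

variable {M : Type*} [AddCommGroup M] [Module (UCurrent 𝔤) M]

theorem cur_smul_smul (c : ℂ) (x : 𝔤) (r : ℕ) (v : M) :
    cur (c • x) r • v = algebraMap ℂ (UCurrent 𝔤) c • cur x r • v := by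
  rw [cur_smul, Algebra.smul_def, mul_smul]

theorem cur_smul_cur_smul (x y : 𝔤) (r s : ℕ) (v : M) :
    cur x r • cur y s • v = cur y s • cur x r • v + cur ⁅x, y⁆ (r + s) • v := by
  rw [← lie_cur_cur, Ring.lie_def, sub_smul, mul_smul, mul_smul, add_sub_cancel]

theorem cur_lie_smul_eq_zero {x y : 𝔤} {r s : ℕ} {v : M} (hx : cur x r • v = 0)
    (hy : cur y s • v = 0) : cur ⁅x, y⁆ (r + s) • v = 0 := by
  have h := cur_smul_cur_smul x y r s v
  rwa [hx, hy, smul_zero, smul_zero, zero_add, eq_comm] at h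

theorem cur_smul_cur_smul_comm {x y : 𝔤} (h : ⁅x, y⁆ = 0) (r s : ℕ) (v : M) :
    cur x r • cur y s • v = cur y s • cur x r • v := by
  rw [cur_smul_cur_smul, h, cur_zero, zero_smul, add_zero]

end CurrentElements

section Relations

variable {𝔤 : Type*} [LieRing 𝔤] [LieAlgebra ℂ 𝔤] [FiniteDimensional ℂ 𝔤] [IsKilling ℂ 𝔤]
  {H : LieSubalgebra ℂ 𝔤} [H.IsCartanSubalgebra]

theorem lie_cur_coroot_cur {α : H.root} {x : 𝔤} (hx : x ∈ rootSpace H (-(α.1 : H → ℂ)))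
    (r s : ℕ) :
    ⁅cur ((coroot α.1 : H) : 𝔤) r, cur x s⁆ = (-2 : ℤ) • cur x (r + s) := by
  rw [lie_cur_cur, coroot_lie_eq α hx, (rootSystem H).pairingIn_same, cur_zsmul]

variable {M : Type*} [AddCommGroup M] [Module (UCurrent 𝔤) M]
  {b : (rootSystem H).Base} {lam mu : weightLattice H} {w : M} {α : H.root} {x : 𝔤}

theorem cur_pow_succ_smul_eq_zero {N n : ℕ} {v : M} (hx : x ∈ rootSpace H (-(α.1 : H → ℂ)))
    (raising : ∀ e ∈ rootSpace H (α.1 : H → ℂ), cur e 0 • v = 0)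
    (weight : cur ((coroot α.1 : H) : 𝔤) 0 • v = (N : ℤ) • v) (hn : cur x 0 ^ n • v = 0) :
    cur x 0 ^ (N + 1) • v = 0 := by
  have := isAddTorsionFree_of_algebra ℂ (UCurrent 𝔤) M
  rcases eq_or_ne x 0 with rfl | hx0
  · rw [cur_zero, zero_pow N.succ_ne_zero, zero_smul]
  obtain ⟨e, he, hex⟩ := exists_lie_eq_coroot hx hx0
  have hlie : ⁅cur e 0, cur x 0⁆ = cur ((coroot α.1 : H) : 𝔤) 0 := by rw [lie_cur_cur, hex]
  exact pow_succ_smul_eq_zero_of_sl2 (by rw [hlie, lie_cur_coroot_cur hx]) (raising e he)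
    (by rw [hlie, weight]) hn

/-- The vector `w` of a `𝔤[t]`-module satisfies the defining relations of `V(λ, μ)`, that is, there
is a homomorphism from `V(λ, μ)` with `w_{λ, μ} ↦ w`. -/
def SatisfiesRelations (b : (rootSystem H).Base) (lam mu : weightLattice H) (w : M) : Prop :=
  ∀ u : UCurrent 𝔤, IsRelator b lam mu u → u • w = 0

namespace SatisfiesRelations

theorem symm (hw : SatisfiesRelations b lam mu w) : SatisfiesRelations b mu lam w := by
  rintro u (⟨α, hα, x, hx, r⟩ | ⟨h, r⟩ | ⟨i, hi, x, hx⟩ | ⟨α, hα, x, hx⟩)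
  · exact hw _ (.raising α hα x hx r)
  · exact add_comm lam mu ▸ hw _ (.cartan h r)
  · exact add_comm lam mu ▸ hw _ (.integrable i hi x hx)
  · exact max_comm (value lam α) _ ▸ hw _ (.lowering α hα x hx)

theorem cartan_smul (hw : SatisfiesRelations b lam mu w) (h : H) {r : ℕ} (hr : r ≠ 0) :
    cur (h : 𝔤) r • w = 0 := by
  simpa [hr] using hw _ (.cartan h r)

theorem cartan_zero_smul (hw : SatisfiesRelations b lam mu w) (h : H) :
    cur (h : 𝔤) 0 • w =
      algebraMap ℂ (UCurrent 𝔤) (((lam + mu : weightLattice H) : Module.Dual ℂ H) h) • w := by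
  have := hw _ (.cartan h 0)
  rwa [if_pos rfl, sub_smul, sub_eq_zero] at this

theorem coroot_smul (hw : SatisfiesRelations b lam mu w) (α : H.root) :
    cur ((coroot α.1 : H) : 𝔤) 0 • w = value (lam + mu) α • w := by
  rw [hw.cartan_zero_smul, value_spec, map_intCast, Int.cast_smul_eq_zsmul]

theorem raising_smul (hw : SatisfiesRelations b lam mu w) (hα : b.IsPos α)
    (hx : x ∈ rootSpace H (α.1 : H → ℂ)) (r : ℕ) : cur x r • w = 0 :=
  hw _ (.raising α hα x hx r)

theorem lowering_smul_of_le (hw : SatisfiesRelations b lam mu w)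
    (hx : x ∈ rootSpace H (-(α.1 : H → ℂ))) {j k : ℕ} (hj : cur x j • w = 0) (hjk : j ≤ k) :
    cur x k • w = 0 := by
  have := isAddTorsionFree_of_algebra ℂ (UCurrent 𝔤) M
  induction k, hjk using Nat.le_induction with
  | base => exact hj
  | succ k _ ih =>
    have h := congrArg (· • w) (lie_cur_coroot_cur hx 1 k)
    simp only [Ring.lie_def, sub_smul, mul_smul, ih, hw.cartan_smul _ one_ne_zero, smul_zero,
      sub_zero, smul_assoc] at h
    rw [add_comm]
    exact (smul_eq_zero.mp h.symm).resolve_left (by norm_num)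

theorem lowering_smul_lowering_smul_of_le (hw : SatisfiesRelations b lam mu w)
    (hx : x ∈ rootSpace H (-(α.1 : H → ℂ))) {i j k : ℕ} (hk : cur x k • w = 0)
    (h : k ≤ i ∨ k ≤ j) : cur x i • cur x j • w = 0 := by
  rcases h with h | h
  · rw [cur_smul_cur_smul_comm (lie_self x), hw.lowering_smul_of_le hx hk h, smul_zero]
  · rw [hw.lowering_smul_of_le hx hk h, smul_zero]

theorem lowering_smul (hw : SatisfiesRelations b lam mu w) (hα : b.IsPos α)
    (hx : x ∈ rootSpace H (-(α.1 : H → ℂ))) {k : ℕ} (h₁ : value lam α ≤ k) (h₂ : value mu α ≤ k) :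
    cur x k • w = 0 :=
  hw.lowering_smul_of_le hx (hw _ (.lowering α hα x hx)) (by omega)

section Cyclic

variable (hw : SatisfiesRelations b lam mu w) (hcyc : Submodule.span (UCurrent 𝔤) {w} = ⊤)
include hw hcyc

theorem exists_pow_smul_eq_zero_of_mem_support {i : H.root} (hi : i ∈ b.support)
    (hx : x ∈ rootSpace H (-(i.1 : H → ℂ))) (v : M) : ∃ n : ℕ, cur x 0 ^ n • v = 0 := by
  obtain ⟨k, hk⟩ :=
    isNilpotent_ad_of_mem_rootSpace H (neg_ne_zero.mpr (H.isNonZero_coe_root i)) hx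
  obtain ⟨u, rfl⟩ := Submodule.mem_span_singleton.mp (hcyc ▸ Submodule.mem_top : v ∈ _)
  have hw0 : ∃ n : ℕ, cur x 0 ^ n • w = 0 := ⟨_, hw _ (.integrable i hi x hx)⟩
  clear hcyc hw
  induction u using ucurrent_induction generalizing w with
  | algebraMap c =>
    obtain ⟨n, hn⟩ := hw0
    exact ⟨n, by rw [← mul_smul, ← Algebra.commutes, mul_smul, hn, smul_zero]⟩
  | cur y r =>
    obtain ⟨n, hn⟩ := hw0
    refine exists_pow_smul_smul_eq_zero (k := k) ?_ hn
    rw [iterate_lie_cur_zero, hk, LinearMap.zero_apply, cur_zero]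
  | add u₁ u₂ h₁ h₂ =>
    obtain ⟨n, hn⟩ := h₁ hw0
    obtain ⟨m, hm⟩ := h₂ hw0
    have hm' : cur x 0 ^ (n + m) • u₂ • w = 0 := by rw [pow_add, mul_smul, hm, smul_zero]
    refine ⟨n + m, ?_⟩
    rw [add_smul, smul_add, hm', add_comm n, pow_add, mul_smul, hn, smul_zero, add_zero]
  | mul u₁ u₂ h₁ h₂ =>
    rw [mul_smul]
    exact h₁ (h₂ hw0)

variable (hs : IsSimplyLaced (rootSystem H)) (hα : b.IsPos α)
  (hx : x ∈ rootSpace H (-(α.1 : H → ℂ)))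
include hs hα hx

theorem exists_pow_smul_eq_zero (v : M) : ∃ n : ℕ, cur x 0 ^ n • v = 0 := by
  have := isAddTorsionFree_of_algebra ℂ (UCurrent 𝔤) M
  refine hα.induction_on_add (p := fun α => ∀ x ∈ rootSpace H (-(α.1 : H → ℂ)), ∀ v : M,
    ∃ n : ℕ, cur x 0 ^ n • v = 0)
    (fun i hi x hx => hw.exists_pow_smul_eq_zero_of_mem_support hcyc hi hx) ?_ x hx v
  intro i j k hk hi hj x hx v
  obtain ⟨y, hy, hy0⟩ := exists_ne_zero_mem_rootSpace_neg i
  obtain ⟨z, hz, hz0⟩ := exists_ne_zero_mem_rootSpace_neg j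
  obtain ⟨c, rfl⟩ := exists_eq_smul_lie_of_root_eq_add hs hk hy hz hy0 hz0 hx
  have hnil := exists_pow_smul_eq_zero_of_commutator (M := M) (e := cur y 0) (x := cur z 0)
    (by simpa only [lie_cur_cur] using
      (commute_cur_of_lie_eq_zero (lie_lie_eq_zero_left hs hk hy hz) 0 0).symm)
    (by simpa only [lie_cur_cur] using
      (commute_cur_of_lie_eq_zero (lie_lie_eq_zero_right hs hk hy hz) 0 0).symm)
    (hi y hy) (hw.exists_pow_smul_eq_zero_of_mem_support hcyc hj hz)
  obtain ⟨n, hn⟩ := hnil v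
  rw [lie_cur_cur] at hn
  exact ⟨n, by rw [cur_smul, smul_pow, Algebra.smul_def, mul_smul, hn, smul_zero]⟩

theorem sum_antidiagonal_smul_eq_zero {s : ℕ} (hs₀ : 0 ≤ value (lam + mu) α)
    (hs₁ : value (lam + mu) α ≤ s + 1) :
    ∑ p ∈ Finset.HasAntidiagonal.antidiagonal s, cur x p.1 • cur x p.2 • w = 0 := by
  have := isAddTorsionFree_of_algebra ℂ (UCurrent 𝔤) M
  rcases eq_or_ne x 0 with rfl | hx0
  · simp [cur_zero]
  obtain ⟨e, he, hex⟩ := exists_lie_eq_coroot hx hx0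
  obtain ⟨n, hn⟩ := hw.exists_pow_smul_eq_zero hcyc hs hα hx w
  lift value (lam + mu) α to ℕ using hs₀ with N hN
  have hpow : cur x 0 ^ (N + 1) • w = 0 :=
    cur_pow_succ_smul_eq_zero hx (fun e he => hw.raising_smul hα he 0)
      (by rw [hw.coroot_smul, hN]) hn
  refine CurrentAlg.sum_antidiagonal_smul_eq_zero (e := cur e 1)
    (h := cur ((coroot α.1 : H) : 𝔤)) (fun p => by rw [lie_cur_cur, hex, add_comm])
    (lie_cur_coroot_cur hx) (commute_cur_of_lie_eq_zero (lie_self x)) (hw.raising_smul hα he 1)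
    (fun q => hw.cartan_smul _ q.succ_ne_zero) ?_
  rw [show s + 2 = (s + 1 - N) + (N + 1) by omega, pow_add, mul_smul, hpow, smul_zero]

theorem lowering_smul_lowering_smul {a : ℕ} (ha₀ : 0 ≤ value (lam + mu) α)
    (ha : value (lam + mu) α ≤ 2 * a + 1) (hxa : cur x (a + 1) • w = 0) :
    cur x a • cur x a • w = 0 := by
  have h := hw.sum_antidiagonal_smul_eq_zero hcyc hs hα hx (s := 2 * a) ha₀ (by exact_mod_cast ha)
  rwa [Finset.sum_eq_single (a, a)] at h
  · rintro ⟨i, j⟩ hij hne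
    have hij' : i + j = 2 * a := by simpa using hij
    have : ¬ (i = a ∧ j = a) := by simpa using hne
    exact hw.lowering_smul_lowering_smul_of_le hx hxa (by omega)
  · intro h
    exact absurd (by simp; omega) h

theorem lowering_smul_lowering_succ_smul {a : ℕ} (ha₀ : 0 ≤ value (lam + mu) α)
    (ha : value (lam + mu) α ≤ 2 * a + 2) (hxa : cur x (a + 2) • w = 0) :
    cur x a • cur x (a + 1) • w = 0 := by
  have := isAddTorsionFree_of_algebra ℂ (UCurrent 𝔤) M
  have h := hw.sum_antidiagonal_smul_eq_zero hcyc hs hα hx (s := 2 * a + 1) ha₀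
    (by push_cast; linarith)
  rw [Finset.sum_eq_add (a, a + 1) (a + 1, a) (by simp),
    cur_smul_cur_smul_comm (lie_self x) (a + 1)] at h
  · exact self_eq_neg.mp (eq_neg_of_add_eq_zero_left h)
  · rintro ⟨i, j⟩ hij hne
    have hij' : i + j = 2 * a + 1 := by simpa using hij
    have : ¬ (i = a ∧ j = a + 1) ∧ ¬ (i = a + 1 ∧ j = a) := by simpa using hne
    exact hw.lowering_smul_lowering_smul_of_le hx hxa (by omega)
  · intro h
    exact absurd (by simp; omega) h
  · intro h
    exact absurd (by simp; omega) h

end Cyclic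

end SatisfiesRelations

end Relations

theorem smul_cur_smul_smul {𝔤 M : Type*} [LieRing 𝔤] [LieAlgebra ℂ 𝔤] [AddCommGroup M]
    [Module (UCurrent 𝔤) M] (u : UCurrent 𝔤) (c : ℂ) (x : 𝔤) (r : ℕ) (v : M) :
    u • cur (c • x) r • v = algebraMap ℂ (UCurrent 𝔤) c • u • cur x r • v := by
  rw [cur_smul_smul, ← mul_smul, ← Algebra.commutes, mul_smul]

theorem ceil_half_le {v : ℤ} {k : ℕ} (h : v ≤ 2 * k) : ⌈(v : ℚ) / 2⌉₊ ≤ k := by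
  rw [Nat.ceil_le, div_le_iff₀' two_pos]
  exact_mod_cast h

theorem le_two_mul_ceil_half (v : ℤ) : v ≤ 2 * (⌈(v : ℚ) / 2⌉₊ : ℕ) := by
  have h := Nat.le_ceil ((v : ℚ) / 2)
  rw [div_le_iff₀' two_pos] at h
  exact_mod_cast h

section Survivor

variable {𝔤 : Type*} [LieRing 𝔤] [LieAlgebra ℂ 𝔤] [FiniteDimensional ℂ 𝔤] [IsKilling ℂ 𝔤]
  {H : LieSubalgebra ℂ 𝔤} [H.IsCartanSubalgebra]

theorem lie_raising_lowering_cases (b : (rootSystem H).Base) {α β : H.root} (hαβ : α ≠ β) {x y : 𝔤}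
    (hy : y ∈ rootSpace H (α.1 : H → ℂ)) (hx : x ∈ rootSpace H (-(β.1 : H → ℂ))) :
    ⁅y, x⁆ = 0 ∨ (∃ γ, b.IsPos γ ∧ ⁅y, x⁆ ∈ rootSpace H (γ.1 : H → ℂ)) ∨
      ∃ γ, b.IsPos γ ∧ (rootSystem H).root β = (rootSystem H).root α + (rootSystem H).root γ ∧
        ⁅y, x⁆ ∈ rootSpace H (-(γ.1 : H → ℂ)) := by
  have hyx : ⁅y, x⁆ ∈ rootSpace H ((α.1 : H → ℂ) + -(β.1 : H → ℂ)) :=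
    lie_mem_genWeightSpace_of_mem_genWeightSpace hy hx
  have hχ : (α.1 : H → ℂ) + -(β.1 : H → ℂ) ≠ 0 := fun h =>
    hαβ ((rootSystem H).root.injective (DFunLike.ext'_iff.mpr (add_neg_eq_zero.mp h)))
  refine (eq_zero_or_exists_root hχ hyx).imp_right ?_
  rintro ⟨δ, hδ⟩
  refine (RootPairing.Base.IsPos.or_neg b δ).imp (fun hpos => ⟨δ, hpos, hδ ▸ hyx⟩) fun hneg => ?_
  have hcoe := coe_reflectionPerm_self δ
  refine ⟨(rootSystem H).reflectionPerm δ δ, hneg, root_eq_add_iff.mpr ?_, ?_⟩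
  · rw [hcoe, hδ]
    abel
  · rwa [hcoe, neg_neg, hδ]

variable {M : Type*} [AddCommGroup M] [Module (UCurrent 𝔤) M] {b : (rootSystem H).Base}
  {lam mu : weightLattice H} {w : M} {α β γ : H.root} {x y : 𝔤} {k : ℕ}

/-- The situation at a root of minimal height: `w` is a cyclic vector with the relations of
`V(λ, μ)`, where `|λ(h_α) - μ(h_α)| ≤ 2` on positive roots, and `β` is a positive root such that
`(x_β⁻ ⊗ t ^ ⌈(λ + μ)(h_β) / 2⌉) w ≠ 0` while the corresponding vectors vanish for the positive
roots of smaller height. If `λ(h_β) > μ(h_β)`, this forces `λ(h_β) = μ(h_β) + 2`; the parameter `k`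
is `μ(h_β)`, so that the exponent of `t` is `k + 1`. -/
structure IsMinimalNonvanishing (b : (rootSystem H).Base) (lam mu : weightLattice H) (w : M)
    (β : H.root) (x : 𝔤) (k : ℕ) : Prop where
  isSimplyLaced : IsSimplyLaced (rootSystem H)
  rel : SatisfiesRelations b lam mu w
  cyclic : Submodule.span (UCurrent 𝔤) {w} = ⊤
  dom_left : IsDominant b lam
  dom_right : IsDominant b mu
  abs_sub_le_two : ∀ α, b.IsPos α → |value lam α - value mu α| ≤ 2
  pos : b.IsPos β
  mem : x ∈ rootSpace H (-(β.1 : H → ℂ))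
  value_left : value lam β = k + 2
  value_right : value mu β = k
  ne_zero : cur x (k + 1) • w ≠ 0
  smul_eq_zero : ∀ α, b.IsPos α → b.height α < b.height β → ∀ y ∈ rootSpace H (-(α.1 : H → ℂ)),
    ∀ j : ℕ, value lam α + value mu α ≤ 2 * j → cur y j • w = 0

namespace IsMinimalNonvanishing

variable (hmin : IsMinimalNonvanishing b lam mu w β x k)
include hmin

theorem x_ne_zero : x ≠ 0 := by
  rintro rfl
  exact hmin.ne_zero (by rw [cur_zero, zero_smul])

theorem root_ne_neg (hα : b.IsPos α) : (rootSystem H).root β ≠ -(rootSystem H).root α := by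
  intro h
  have hperm : (rootSystem H).reflectionPerm α α = β := by
    apply (rootSystem H).root.injective
    rw [(rootSystem H).root_reflectionPerm, (rootSystem H).reflection_apply_self, h]
  have hheight := b.height_reflectionPerm_self α
  have hβ := hmin.pos
  rw [b.isPos_iff] at hα hβ
  change b.height ((rootSystem H).reflectionPerm α α) = _ at hheight
  rw [hperm] at hheight
  omega

theorem value_eq_add_one_of_root_eq_add (hα : b.IsPos α) (hγ : b.IsPos γ)
    (h : (rootSystem H).root β = (rootSystem H).root α + (rootSystem H).root γ) :
    value lam α = value mu α + 1 ∧ value lam γ = value mu γ + 1 := by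
  have hht := b.height_add h
  rw [b.isPos_iff] at hα hγ
  have hlam := hmin.value_left ▸ value_of_root_add hmin.isSimplyLaced lam h
  have hmu := hmin.value_right ▸ value_of_root_add hmin.isSimplyLaced mu h
  have hdα := abs_le.mp (hmin.abs_sub_le_two α hα)
  have hdγ := abs_le.mp (hmin.abs_sub_le_two γ hγ)
  -- As `α` and `γ` have smaller height than `β`, even sums would make `(x_β⁻ ⊗ t ^ (k + 1)) w` a
  -- multiple of the commutator of two elements killing `w`.
  have not_even (a c : ℕ) (ha : value lam α + value mu α = 2 * a)
      (hc : value lam γ + value mu γ = 2 * c) : False := by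
    obtain ⟨y, hy, hy0⟩ := exists_ne_zero_mem_rootSpace_neg α
    obtain ⟨z, hz, hz0⟩ := exists_ne_zero_mem_rootSpace_neg γ
    have hyz := cur_lie_smul_eq_zero (hmin.smul_eq_zero α hα (by omega) y hy a ha.le)
      (hmin.smul_eq_zero γ hγ (by omega) z hz c hc.le)
    obtain ⟨r, rfl⟩ := exists_eq_smul_lie_of_root_eq_add hmin.isSimplyLaced h hy hz hy0 hz0 hmin.mem
    exact hmin.ne_zero (by rw [show k + 1 = a + c by omega, cur_smul_smul, hyz, smul_zero])
  have hlamα := hmin.dom_left.value_nonneg hmin.isSimplyLaced hα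
  have hmuα := hmin.dom_right.value_nonneg hmin.isSimplyLaced hα
  have hlamγ := hmin.dom_left.value_nonneg hmin.isSimplyLaced hγ
  have hmuγ := hmin.dom_right.value_nonneg hmin.isSimplyLaced hγ
  obtain ⟨a, ha | ha⟩ := Int.even_or_odd' (value lam α + value mu α)
  · exact (not_even a.toNat (k + 1 - a).toNat (by omega) (by omega)).elim
  · omega

theorem isDominant_sub : IsDominant b (lam - rootWeight β) := by
  intro i hi
  rw [value_sub, value_rootWeight]
  have hpos := RootPairing.Base.isPos_of_mem_support hi
  have hlam := hmin.dom_left i hi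
  rcases eq_or_ne β i with rfl | hβi
  · rw [hmin.value_left, (rootSystem H).pairingIn_same]
    omega
  rcases hmin.isSimplyLaced.pairingIn_mem hβi (hmin.root_ne_neg hpos) with h | h | h
  · omega
  · omega
  · obtain ⟨γ, hγ⟩ := (rootSystem H).root_sub_root_mem_of_pairingIn_pos (by rw [h]; exact one_pos)
      hβi
    have hval := hmin.value_eq_add_one_of_root_eq_add (hmin.pos.sub hi hγ) hpos
      (by rw [hγ, sub_add_cancel])
    have hmu := hmin.dom_right i hi
    omega

theorem raising_smul (hα : b.IsPos α) (hy : y ∈ rootSpace H (α.1 : H → ℂ)) (r : ℕ) :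
    cur y r • cur x (k + 1) • w = 0 := by
  rw [cur_smul_cur_smul, hmin.rel.raising_smul hα hy, smul_zero, zero_add]
  rcases eq_or_ne α β with rfl | hαβ
  · have hyx : ⁅y, x⁆ ∈ rootSpace H ((α.1 : H → ℂ) + -(α.1 : H → ℂ)) :=
      lie_mem_genWeightSpace_of_mem_genWeightSpace hy hmin.mem
    rw [add_neg_cancel, rootSpace_zero_eq] at hyx
    exact hmin.rel.cartan_smul ⟨_, hyx⟩ (by omega)
  rcases lie_raising_lowering_cases b hαβ hy hmin.mem with h | ⟨γ, hγ, h⟩ | ⟨γ, hγ, hβ, h⟩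
  · rw [h, cur_zero, zero_smul]
  · exact hmin.rel.raising_smul hγ h _
  · have hht := b.height_add hβ
    have hval := hmin.value_eq_add_one_of_root_eq_add hα hγ hβ
    have hmu := hmin.value_right ▸ value_of_root_add hmin.isSimplyLaced mu hβ
    have hmuα := hmin.dom_right.value_nonneg hmin.isSimplyLaced hα
    rw [b.isPos_iff] at hα
    exact hmin.smul_eq_zero γ hγ (by omega) _ h _ (by push_cast; omega)

theorem cartan_smul (h : H) (r : ℕ) :
    cur (h : 𝔤) r • cur x (k + 1) • w =
      algebraMap ℂ (UCurrent 𝔤) (if r = 0 then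
        ((lam - rootWeight β + mu : weightLattice H) : Module.Dual ℂ H) h else 0) •
        cur x (k + 1) • w := by
  rw [cur_smul_cur_smul, lie_eq_neg_smul_of_mem_rootSpace_neg hmin.mem, cur_smul_smul]
  rcases eq_or_ne r 0 with rfl | hr
  · have hweight : ((lam - rootWeight β + mu : weightLattice H) : Module.Dual ℂ H) h =
        ((lam + mu : weightLattice H) : Module.Dual ℂ H) h + -β.1 h := by
      rw [sub_add_eq_add_sub, AddSubgroup.coe_sub, LinearMap.sub_apply, sub_eq_add_neg]
      rfl
    rw [hmin.rel.cartan_zero_smul, if_pos rfl, hweight, map_add, add_smul, zero_add, ← mul_smul,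
      ← Algebra.commutes, mul_smul]
  · have hx : cur x (r + (k + 1)) • w = 0 := by
      refine hmin.rel.lowering_smul hmin.pos hmin.mem ?_ ?_
      · rw [hmin.value_left]; push_cast; omega
      · rw [hmin.value_right]; push_cast; omega
    rw [hmin.rel.cartan_smul h hr, hx, smul_zero, smul_zero, add_zero, if_neg hr, map_zero,
      zero_smul]

theorem lowering_self_smul : cur x k • cur x (k + 1) • w = 0 := by
  have hleft := hmin.value_left
  have hright := hmin.value_right
  have hsum := value_add lam mu β
  exact hmin.rel.lowering_smul_lowering_succ_smul hmin.cyclic hmin.isSimplyLaced hmin.pos hmin.mem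
    (by omega) (by omega)
    (hmin.rel.lowering_smul hmin.pos hmin.mem (by push_cast; omega) (by push_cast; omega))

theorem lowering_smul_of_root_eq_add_right (hα : b.IsPos α) (hγ : b.IsPos γ)
    (h : (rootSystem H).root β = (rootSystem H).root α + (rootSystem H).root γ)
    (hy : y ∈ rootSpace H (-(α.1 : H → ℂ))) {a : ℕ} (ha : value mu α = a) :
    cur y a • cur x (k + 1) • w = 0 := by
  rcases eq_or_ne y 0 with rfl | hy0
  · rw [cur_zero, zero_smul]
  obtain ⟨z, hz, hz0⟩ := exists_ne_zero_mem_rootSpace_neg γ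
  obtain ⟨r, rfl⟩ := exists_eq_smul_lie_of_root_eq_add hmin.isSimplyLaced h hy hz hy0 hz0 hmin.mem
  obtain ⟨hαval, hγval⟩ := hmin.value_eq_add_one_of_root_eq_add hα hγ h
  have hmu := hmin.value_right ▸ value_of_root_add hmin.isSimplyLaced mu h
  have hsum := value_add lam mu α
  obtain ⟨c, hc⟩ := Int.eq_ofNat_of_zero_le (hmin.dom_right.value_nonneg hmin.isSimplyLaced hγ)
  obtain rfl : k = a + c := by omega
  have hyy : cur y a • cur y a • w = 0 :=
    hmin.rel.lowering_smul_lowering_smul hmin.cyclic hmin.isSimplyLaced hα hy (by omega) (by omega)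
      (hmin.rel.lowering_smul hα hy (by push_cast; omega) (by push_cast; omega))
  have hzw : cur z (c + 1) • w = 0 :=
    hmin.rel.lowering_smul hγ hz (by push_cast; omega) (by push_cast; omega)
  have hcomm : Commute (cur y a) ⁅cur y a, cur z (c + 1)⁆ := by
    rw [lie_cur_cur]
    exact commute_cur_of_lie_eq_zero (lie_lie_eq_zero_left hmin.isSimplyLaced h hy hz) _ _
  have := isAddTorsionFree_of_algebra ℂ (UCurrent 𝔤) M
  rw [smul_cur_smul_smul, add_assoc, ← lie_cur_cur, smul_lie_smul_eq_zero hcomm hyy hzw, smul_zero]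

theorem lie_smul_of_value_eq (hγ : b.IsPos γ)
    (h : (rootSystem H).root α = (rootSystem H).root β + (rootSystem H).root γ)
    (hy : y ∈ rootSpace H (-(γ.1 : H → ℂ))) {c : ℕ} (hlam : value lam γ = c)
    (hmu : value mu γ = c) : cur ⁅x, y⁆ (k + 1 + c) • cur x (k + 1) • w = 0 := by
  have hleft := hmin.value_left
  have hright := hmin.value_right
  have hsum := value_add lam mu β
  have hxx : cur x (k + 1) • cur x (k + 1) • w = 0 :=
    hmin.rel.lowering_smul_lowering_smul hmin.cyclic hmin.isSimplyLaced hmin.pos hmin.mem (by omega)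
      (by push_cast; omega)
      (hmin.rel.lowering_smul hmin.pos hmin.mem (by push_cast; omega) (by push_cast; omega))
  have hyw : cur y c • w = 0 := hmin.rel.lowering_smul hγ hy hlam.le hmu.le
  have hcomm : Commute (cur x (k + 1)) ⁅cur x (k + 1), cur y c⁆ := by
    rw [lie_cur_cur]
    exact commute_cur_of_lie_eq_zero (lie_lie_eq_zero_left hmin.isSimplyLaced h hmin.mem hy) _ _
  have := isAddTorsionFree_of_algebra ℂ (UCurrent 𝔤) M
  rw [← lie_cur_cur, ← mul_smul, ← hcomm.eq, mul_smul, smul_lie_smul_eq_zero hcomm hxx hyw]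

theorem lie_smul_of_value_eq_add_one (hα : b.IsPos α) (hγ : b.IsPos γ)
    (h : (rootSystem H).root α = (rootSystem H).root β + (rootSystem H).root γ)
    (hy : y ∈ rootSpace H (-(γ.1 : H → ℂ))) {c : ℕ} (hlam : value lam γ = c)
    (hmu : value mu γ = c + 1) : cur ⁅x, y⁆ (k + (c + 1)) • cur x (k + 1) • w = 0 := by
  have hlamα := hmin.value_left ▸ hlam ▸ value_of_root_add hmin.isSimplyLaced lam h
  have hmuα := hmin.value_right ▸ hmu ▸ value_of_root_add hmin.isSimplyLaced mu h
  have hyw : cur y (c + 1) • w = 0 :=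
    hmin.rel.lowering_smul hγ hy (by push_cast; omega) (by push_cast; omega)
  have hlie : cur ⁅x, y⁆ (k + 1 + (c + 1)) • w = 0 :=
    hmin.rel.lowering_smul hα (lie_mem_rootSpace_neg h hmin.mem hy) (by push_cast; omega)
      (by push_cast; omega)
  refine cur_lie_smul_eq_zero hmin.lowering_self_smul ?_
  have hswap := cur_smul_cur_smul x y (k + 1) (c + 1) w
  rwa [hyw, smul_zero, hlie, add_zero, eq_comm] at hswap

theorem lowering_smul_of_root_eq_add_left (hα : b.IsPos α) (hγ : b.IsPos γ)
    (h : (rootSystem H).root α = (rootSystem H).root β + (rootSystem H).root γ)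
    (hlt : value mu α < value lam α) (hy : y ∈ rootSpace H (-(α.1 : H → ℂ))) {m : ℕ}
    (hm : value lam α = m + 1) : cur y m • cur x (k + 1) • w = 0 := by
  obtain ⟨z, hz, hz0⟩ := exists_ne_zero_mem_rootSpace_neg γ
  obtain ⟨r, rfl⟩ :=
    exists_eq_smul_lie_of_root_eq_add hmin.isSimplyLaced h hmin.mem hz hmin.x_ne_zero hz0 hy
  rw [cur_smul_smul]
  have hlamα := hmin.value_left ▸ value_of_root_add hmin.isSimplyLaced lam h
  have hmuα := hmin.value_right ▸ value_of_root_add hmin.isSimplyLaced mu h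
  have hdα := abs_le.mp (hmin.abs_sub_le_two α hα)
  obtain ⟨c, hc⟩ := Int.eq_ofNat_of_zero_le (hmin.dom_left.value_nonneg hmin.isSimplyLaced hγ)
  obtain hc' | hc' : value mu γ = c ∨ value mu γ = c + 1 := by omega
  · rw [show m = k + 1 + c by omega, hmin.lie_smul_of_value_eq hγ h hz hc hc', smul_zero]
  · rw [show m = k + (c + 1) by omega, hmin.lie_smul_of_value_eq_add_one hα hγ h hz hc hc',
      smul_zero]

theorem lowering_smul_of_pairingIn_eq_one (hα : b.IsPos α)
    (hβα : (rootSystem H).pairingIn ℤ β α = 1) (hy : y ∈ rootSpace H (-(α.1 : H → ℂ))) {m : ℕ}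
    (hm : (m : ℤ) = max (value lam α - 1) (value mu α)) : cur y m • cur x (k + 1) • w = 0 := by
  rcases le_or_gt (value lam α) (value mu α) with hle | hlt
  · have hyx : ⁅y, x⁆ = 0 := lie_eq_zero_of_pairingIn_nonneg hmin.isSimplyLaced
      (by rw [hmin.isSimplyLaced, hβα]; exact zero_le_one) hy hmin.mem
    rw [cur_smul_cur_smul_comm hyx, hmin.rel.lowering_smul hα hy (by omega) (by omega), smul_zero]
  have hne : β ≠ α := by
    rintro rfl
    rw [(rootSystem H).pairingIn_same] at hβα
    omega
  obtain ⟨δ, hδ⟩ := (rootSystem H).root_sub_root_mem_of_pairingIn_pos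
    (by rw [hβα]; exact one_pos) hne
  rcases RootPairing.Base.IsPos.or_neg b δ with hpos | hneg
  · have hβ : (rootSystem H).root β = (rootSystem H).root α + (rootSystem H).root δ := by
      rw [hδ, add_sub_cancel]
    have := hmin.value_eq_add_one_of_root_eq_add hα hpos hβ
    exact hmin.lowering_smul_of_root_eq_add_right hα hpos hβ hy (by omega)
  · change b.IsPos ((rootSystem H).reflectionPerm δ δ) at hneg
    refine hmin.lowering_smul_of_root_eq_add_left hα hneg ?_ hlt hy (by omega)
    rw [(rootSystem H).root_reflectionPerm, (rootSystem H).reflection_apply_self, hδ, neg_sub,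
      add_sub_cancel]

theorem lowering_smul (hα : b.IsPos α) (hy : y ∈ rootSpace H (-(α.1 : H → ℂ))) {m : ℕ}
    (hm : (m : ℤ) = max (value (lam - rootWeight β) α) (value mu α)) :
    cur y m • cur x (k + 1) • w = 0 := by
  rw [value_sub, value_rootWeight] at hm
  rcases eq_or_ne β α with rfl | hβα
  · obtain ⟨r, rfl⟩ := exists_eq_smul_of_mem_rootSpace_neg hmin.mem hy hmin.x_ne_zero
    rw [(rootSystem H).pairingIn_same, hmin.value_left, hmin.value_right] at hm
    rw [show m = k by omega, cur_smul_smul, hmin.lowering_self_smul, smul_zero]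
  rcases hmin.isSimplyLaced.pairingIn_mem hβα (hmin.root_ne_neg hα) with h | h | h
  · obtain ⟨γ, hγ⟩ := (rootSystem H).root_add_root_mem_of_pairingIn_neg (by rw [h]; norm_num)
      (hmin.root_ne_neg hα)
    rw [add_comm] at hγ
    have hlam := hmin.value_left ▸ value_of_root_add hmin.isSimplyLaced lam hγ
    have hmu := hmin.value_right ▸ value_of_root_add hmin.isSimplyLaced mu hγ
    rw [cur_smul_cur_smul, hmin.rel.lowering_smul hα hy (by omega) (by omega), smul_zero, zero_add]
    exact hmin.rel.lowering_smul (hα.add hmin.pos hγ) (lie_mem_rootSpace_neg hγ hy hmin.mem)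
      (by push_cast; omega) (by push_cast; omega)
  · have hyx : ⁅y, x⁆ = 0 :=
      lie_eq_zero_of_pairingIn_nonneg hmin.isSimplyLaced (by rw [hmin.isSimplyLaced, h]) hy hmin.mem
    rw [cur_smul_cur_smul_comm hyx, hmin.rel.lowering_smul hα hy (by omega) (by omega), smul_zero]
  · exact hmin.lowering_smul_of_pairingIn_eq_one hα h hy (h ▸ hm)

theorem satisfiesRelations : SatisfiesRelations b (lam - rootWeight β) mu (cur x (k + 1) • w) := by
  rintro u (⟨α, hα, y, hy, r⟩ | ⟨h, r⟩ | ⟨i, hi, y, hy⟩ | ⟨α, hα, y, hy⟩)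
  · exact hmin.raising_smul hα hy r
  · rw [sub_smul, hmin.cartan_smul h r, sub_self]
  · have hpos := RootPairing.Base.isPos_of_mem_support hi
    have hnonneg := (hmin.isDominant_sub.add hmin.dom_right) i hi
    obtain ⟨n, hn⟩ := hmin.rel.exists_pow_smul_eq_zero hmin.cyclic hmin.isSimplyLaced hpos hy
      (cur x (k + 1) • w)
    refine cur_pow_succ_smul_eq_zero hy (fun e he => hmin.raising_smul hpos he 0) ?_ hn
    rw [hmin.cartan_smul, if_pos rfl, value_spec, map_intCast, Int.cast_smul_eq_zsmul,
      Int.toNat_of_nonneg hnonneg]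
  · exact hmin.lowering_smul hα hy (Int.toNat_of_nonneg
      (le_max_of_le_right (hmin.dom_right.value_nonneg hmin.isSimplyLaced hα)))

end IsMinimalNonvanishing

theorem satisfiesRelations_gen (b : (rootSystem H).Base) (lam mu : weightLattice H) :
    SatisfiesRelations b lam mu (gen b lam mu) := by
  intro u hu
  rw [gen, ← map_smul, smul_eq_mul, mul_one, Submodule.mkQ_apply, Submodule.Quotient.mk_eq_zero]
  exact Submodule.subset_span hu

theorem span_gen_eq_top (b : (rootSystem H).Base) (lam mu : weightLattice H) :
    Submodule.span (UCurrent 𝔤) {gen b lam mu} = ⊤ := by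
  refine Submodule.eq_top_iff'.mpr fun v => Submodule.mem_span_singleton.mpr ?_
  obtain ⟨u, rfl⟩ := (relIdeal b lam mu).mkQ_surjective v
  exact ⟨u, by rw [gen, ← map_smul, smul_eq_mul, mul_one]⟩

theorem SatisfiesRelations.exists_surjective (hw : SatisfiesRelations b lam mu w) :
    ∃ φ : V b lam mu →ₗ[UCurrent 𝔤] Submodule.span (UCurrent 𝔤) {w},
      Function.Surjective φ ∧ (φ (gen b lam mu) : M) = w := by
  have hle : relIdeal b lam mu ≤ LinearMap.ker (LinearMap.toSpanSingleton (UCurrent 𝔤)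
      (Submodule.span (UCurrent 𝔤) {w}) ⟨w, Submodule.mem_span_singleton_self w⟩) := by
    refine Submodule.span_le.mpr fun u hu => ?_
    rw [SetLike.mem_coe, LinearMap.mem_ker, LinearMap.toSpanSingleton_apply]
    exact Subtype.ext (hw u hu)
  refine ⟨(relIdeal b lam mu).liftQ _ hle, ?_, ?_⟩
  · rintro ⟨v, hv⟩
    obtain ⟨u, rfl⟩ := Submodule.mem_span_singleton.mp hv
    exact ⟨(relIdeal b lam mu).mkQ u, rfl⟩
  · rw [gen, Submodule.mkQ_apply, Submodule.liftQ_apply, LinearMap.toSpanSingleton_apply, one_smul]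

section MinimalHeight

variable (hs : IsSimplyLaced (rootSystem H)) (hw : SatisfiesRelations b lam mu w)
  (hcyc : Submodule.span (UCurrent 𝔤) {w} = ⊤) (hlam : IsDominant b lam) (hmu : IsDominant b mu)
  (hdiff : ∀ α, b.IsPos α → |value lam α - value mu α| ≤ 2)
  {xm : H.root → 𝔤} (hxm : ∀ α, xm α ∈ rootSpace H (-(α.1 : H → ℂ))) (hxm0 : ∀ α, xm α ≠ 0)
  (hβ : b.IsPos β) (hne : cur (xm β) ⌈(value (lam + mu) β : ℚ) / 2⌉₊ • w ≠ 0)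
  (hmin : ∀ α, b.IsPos α → cur (xm α) ⌈(value (lam + mu) α : ℚ) / 2⌉₊ • w ≠ 0 →
    b.height β ≤ b.height α)
  (hlt : value mu β < value lam β)
include hs hw hcyc hlam hmu hdiff hxm hxm0 hβ hne hmin hlt

theorem exists_isMinimalNonvanishing :
    ∃ k : ℕ, ⌈(value (lam + mu) β : ℚ) / 2⌉₊ = k + 1 ∧
      IsMinimalNonvanishing b lam mu w β (xm β) k := by
  have hsum := value_add lam mu β
  have hceil := le_two_mul_ceil_half (value (lam + mu) β)
  have hdβ := abs_le.mp (hdiff β hβ)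
  obtain ⟨k, hk⟩ := Int.eq_ofNat_of_zero_le (hmu.value_nonneg hs hβ)
  have hne_one : value lam β ≠ value mu β + 1 := fun h =>
    hne (hw.lowering_smul hβ (hxm β) (by omega) (by omega))
  have hle : ⌈(value (lam + mu) β : ℚ) / 2⌉₊ ≤ k + 1 := ceil_half_le (by push_cast; omega)
  have heq : ⌈(value (lam + mu) β : ℚ) / 2⌉₊ = k + 1 := by omega
  refine ⟨k, heq, hs, hw, hcyc, hlam, hmu, hdiff, hβ, hxm β, by omega, hk, heq ▸ hne, ?_⟩
  intro α hα hht y hy j hj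
  have hzero : cur (xm α) ⌈(value (lam + mu) α : ℚ) / 2⌉₊ • w = 0 :=
    not_not.mp fun h => (hmin α hα h).not_gt hht
  obtain ⟨c, rfl⟩ := exists_eq_smul_of_mem_rootSpace_neg (hxm α) hy (hxm0 α)
  rw [cur_smul_smul, hw.lowering_smul_of_le (hxm α) hzero
    (ceil_half_le (by rw [value_add]; exact hj)), smul_zero]

theorem isDominant_sub_and_satisfiesRelations :
    IsDominant b (lam - rootWeight β) ∧
      SatisfiesRelations b (lam - rootWeight β) mu
        (cur (xm β) ⌈(value (lam + mu) β : ℚ) / 2⌉₊ • w) := by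
  obtain ⟨k, hk, hk_min⟩ :=
    exists_isMinimalNonvanishing hs hw hcyc hlam hmu hdiff hxm hxm0 hβ hne hmin hlt
  exact ⟨hk_min.isDominant_sub, hk ▸ hk_min.satisfiesRelations⟩

end MinimalHeight

end Survivor

end CurrentAlg

end

open CurrentAlg LieAlgebra LieAlgebra.IsKilling in
theorem mainTheorem6_general {𝔤 : Type*} [LieRing 𝔤] [LieAlgebra ℂ 𝔤] [FiniteDimensional ℂ 𝔤]
    [IsKilling ℂ 𝔤] {H : LieSubalgebra ℂ 𝔤} [H.IsCartanSubalgebra]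
    (hs : IsSimplyLaced (rootSystem H)) {b : (rootSystem H).Base}
    {xm : H.root → 𝔤} (hxm : ∀ α, xm α ∈ rootSpace H (-(α.1 : H → ℂ))) (hxm0 : ∀ α, xm α ≠ 0)
    {nu₁ nu₂ : weightLattice H} (hnu₁ : IsDominant b nu₁) (hnu₂ : IsDominant b nu₂)
    (hdiff : ∀ α, b.IsPos α → |value nu₁ α - value nu₂ α| ≤ 2)
    {β : H.root} (hβ : b.IsPos β) (hne : midVector b nu₁ nu₂ β (xm β) ≠ 0)
    (hmin : ∀ α, b.IsPos α → midVector b nu₁ nu₂ α (xm α) ≠ 0 → b.height β ≤ b.height α) :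
    (value nu₂ β < value nu₁ β →
      IsDominant b (nu₁ - rootWeight β) ∧
      ∃ φ : V b (nu₁ - rootWeight β) nu₂ →ₗ[UCurrent 𝔤]
          Submodule.span (UCurrent 𝔤) {midVector b nu₁ nu₂ β (xm β)},
        Function.Surjective φ ∧
        (φ (gen b (nu₁ - rootWeight β) nu₂) : V b nu₁ nu₂) = midVector b nu₁ nu₂ β (xm β)) ∧
    (value nu₁ β < value nu₂ β →
      IsDominant b (nu₂ - rootWeight β) ∧
      ∃ φ : V b nu₁ (nu₂ - rootWeight β) →ₗ[UCurrent 𝔤]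
          Submodule.span (UCurrent 𝔤) {midVector b nu₁ nu₂ β (xm β)},
        Function.Surjective φ ∧
        (φ (gen b nu₁ (nu₂ - rootWeight β)) : V b nu₁ nu₂) = midVector b nu₁ nu₂ β (xm β)) := by
  have hrel := satisfiesRelations_gen b nu₁ nu₂
  have hcyc := span_gen_eq_top b nu₁ nu₂
  constructor
  · intro hlt
    obtain ⟨hdom, hu⟩ := isDominant_sub_and_satisfiesRelations hs hrel hcyc hnu₁ hnu₂ hdiff
      hxm hxm0 hβ hne hmin hlt
    exact ⟨hdom, hu.exists_surjective⟩
  · intro hlt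
    simp only [midVector, add_comm nu₁ nu₂] at hne hmin
    obtain ⟨hdom, hu⟩ := isDominant_sub_and_satisfiesRelations hs hrel.symm hcyc hnu₂ hnu₁
      (fun α hα => abs_sub_comm (value nu₁ α) _ ▸ hdiff α hα) hxm hxm0 hβ hne hmin hlt
    rw [add_comm nu₂ nu₁] at hu
    exact ⟨hdom, hu.symm.exists_surjective⟩

open CurrentAlg LieAlgebra LieAlgebra.IsKilling in
theorem mainTheorem6 {𝔤 : Type*} [LieRing 𝔤] [LieAlgebra ℂ 𝔤] [FiniteDimensional ℂ 𝔤]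
    [IsSimple ℂ 𝔤] (H : LieSubalgebra ℂ 𝔤) [H.IsCartanSubalgebra]
    (b : (rootSystem H).Base) {n : ℕ} (e : Fin n ≃ b.support) (htype : IsTypeAD b e)
    -- `xm α` is a root vector `x_α⁻`
    (xm : H.root → 𝔤) (hxm : ∀ α, xm α ∈ rootSpace H (-(α.1 : H → ℂ))) (hxm0 : ∀ α, xm α ≠ 0)
    (lam₁ lam₂ nu : weightLattice H)
    (hlam₁ : IsDominant b lam₁) (hlam₂ : IsDominant b lam₂) (hnu : IsDominant b nu)
    (hint : IsInterlacing e lam₁ lam₂)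
    (nu₁ nu₂ : weightLattice H) (hnu₁ : nu₁ = lam₁ + nu) (hnu₂ : nu₂ = lam₂ + nu)
    (β : H.root) (hβ : b.IsPos β)
    (hne : midVector b nu₁ nu₂ β (xm β) ≠ 0)
    (hmin : ∀ α : H.root, b.IsPos α → midVector b nu₁ nu₂ α (xm α) ≠ 0 → b.height β ≤ b.height α) :
    (value nu₂ β < value nu₁ β →
      IsDominant b (nu₁ - rootWeight β) ∧
      ∃ φ : V b (nu₁ - rootWeight β) nu₂ →ₗ[UCurrent 𝔤]
          Submodule.span (UCurrent 𝔤) {midVector b nu₁ nu₂ β (xm β)},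
        Function.Surjective φ ∧
        (φ (gen b (nu₁ - rootWeight β) nu₂) : V b nu₁ nu₂) = midVector b nu₁ nu₂ β (xm β)) ∧
    (value nu₁ β < value nu₂ β →
      IsDominant b (nu₂ - rootWeight β) ∧
      ∃ φ : V b nu₁ (nu₂ - rootWeight β) →ₗ[UCurrent 𝔤]
          Submodule.span (UCurrent 𝔤) {midVector b nu₁ nu₂ β (xm β)},
        Function.Surjective φ ∧
        (φ (gen b nu₁ (nu₂ - rootWeight β)) : V b nu₁ nu₂) = midVector b nu₁ nu₂ β (xm β)) := by
  subst hnu₁ hnu₂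
  have hdiff (α : H.root) (hα : b.IsPos α) :
      |value (lam₁ + nu) α - value (lam₂ + nu) α| ≤ 2 := by
    rw [← value_sub, add_sub_add_right_eq_sub]
    exact hint.abs_value_sub_le_two htype hlam₁ hlam₂ hα
  exact mainTheorem6_general htype.isSimplyLaced hxm hxm0 (hlam₁.add hnu) (hlam₂.add hnu) hdiff
    hβ hne hmin
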